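/- **Proposition (duality in TT gauge).** Work on Minkowski spacetime $\mathbb{R}^4$ with coordinates $(x^0,x^1,x^2,x^3)$, $x^0$ being time, and metric $\eta=\mathrm{diag}(1,-1,-1,-1)$, which raises and lowers indices $a,b,\dots\in\{0,1,2,3\}$; all tensor fields are smooth ($C^\infty$), and domains are nonempty, open and connected. For a symmetric tensor field $h_{ab}$ put $h=h_a{}^a$, let $$R_{abcd}=\tfrac12(\partial_b\partial_c h_{ad}+\partial_a\partial_d h_{bc}-\partial_a\partial_c h_{bd}-\partial_b\partial_d h_{ac}),\quad R_{ab}=\eta^{cd}R_{acbd},\quad R=\eta^{ab}R_{ab},\quad G_{ab}=R_{ab}-\tfrac12\eta_{ab}R$$ be the linearized Riemann, Ricci, scalar and Einstein curvatures, and let $$F_{abc}=\tfrac12\bigl(\partial_a h_{bc}-\partial_b h_{ac}+\partial_d h^d{}_a\,\eta_{bc}-\partial_d h^d{}_b\,\eta_{ac}-\partial_a h\,\eta_{bc}+\partial_b h\,\eta_{ac}\bigr)$$ be the Fierz tensor of $h_{ab}$, with dual $\tilde F^{abc}=\tfrac12\epsilon^{abde}F_{de}{}^{c}$, where $\epsilon^{abcd}$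 is totally antisymmetric and $\epsilon^{0123}=1$. A *source-free solution* is a symmetric tensor field $h_{ab}$ with $G_{ab}=0$. A source-free solution $h'_{ab}$ is a *dual* of a source-free solution $h_{ab}$ if the Fierz tensor of $h'_{ab}$ equals $\tilde F_{abc}$, the dual of the Fierz tensor of $h_{ab}$. The *TT gauge conditions* are $\partial_a h^{ab}=0$, $h_a{}^a=0$ and $h_{a0}=0$ for all $a\in\{0,1,2,3\}$. Let $\Omega\subseteq\mathbb{R}^4$ be a domain with $H^2_{\mathrm{dR}}(\Omega)=0$, and let $h_{ab}$ be a source-free solution on $\Omega$ that satisfies the TT gauge conditions on $\Omega$. Let $U$ be a bounded domain with $\overline U\subset\Omega$ and $H^1_{\mathrm{dR}}(U)=0$. Let $\mathcal R=[t_0,t_1]\times\Sigma$, where $t_0<t_1$ and $\Sigma\subseteq\mathbb{R}^3$ is a domain, be such that $\overline{\mathcal R}\subset U$. Then $h_{ab}$ has a dual, defined on $\mathcal R$, that satisfies the TT gauge conditions on $\mathcal R$. (At the times $t_0$ and $t_1$, smoothness and derivatives of fields on $\mathcal R$ are understood relative to $\mathcal R$, i.e. one-sidedly in time.) -/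

import Mathlib

open scoped ContDiff

noncomputable section

/-! ### De Rham cohomology of an open subset of a normed space -/

namespace DeRham

variable {E : Type*} [NormedAddCommGroup E] [NormedSpace ℝ E]

/-- Differential `k`-forms on `E`, with no regularity required. -/
def Form (E : Type*) [NormedAddCommGroup E] [NormedSpace ℝ E] (k : ℕ) : Type _ :=
  E → E [⋀^Fin k]→L[ℝ] ℝ

instance (k : ℕ) : AddCommGroup (Form E k) :=
  inferInstanceAs (AddCommGroup (E → E [⋀^Fin k]→L[ℝ] ℝ))

instance (k : ℕ) : Module ℝ (Form E k) :=
  inferInstanceAs (Module ℝ (E → E [⋀^Fin k]→L[ℝ] ℝ))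

theorem extDeriv_zero_form (k : ℕ) (x : E) :
    extDeriv (0 : E → E [⋀^Fin k]→L[ℝ] ℝ) x = 0 := by
  simpa using extDeriv_smul (𝕜 := ℝ) (x := x) (0 : ℝ) (0 : E → E [⋀^Fin k]→L[ℝ] ℝ)

/-- Smooth closed `k`-forms on the open set `M`. A form on `M` is represented by a function on the
whole space; its values outside `M` are irrelevant. -/
def closedForms (M : TopologicalSpace.Opens E) (k : ℕ) : Submodule ℝ (Form E k) where
  carrier := {α : E → E [⋀^Fin k]→L[ℝ] ℝ | ContDiffOn ℝ ∞ α M ∧ ∀ x ∈ M, extDeriv α x = 0}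
  zero_mem' := by
    exact ⟨contDiffOn_const, fun x _ => extDeriv_zero_form k x⟩
  add_mem' := by
    rintro α₁ α₂ ⟨h₁, h₁'⟩ ⟨h₂, h₂'⟩
    refine ⟨h₁.add h₂, fun x hx => ?_⟩
    have hM : (M : Set E) ∈ nhds x := M.isOpen.mem_nhds hx
    refine (extDeriv_add ((h₁.contDiffAt hM).differentiableAt (by simp))
      ((h₂.contDiffAt hM).differentiableAt (by simp))).trans ?_
    rw [h₁' x hx, h₂' x hx, add_zero]
  smul_mem' := by
    rintro c α ⟨h, h'⟩
    refine ⟨contDiffOn_const.smul h, fun x hx => (extDeriv_smul c _).trans ?_⟩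
    rw [h' x hx, smul_zero]

/-- The `k`-forms that on the open set `M` coincide with the exterior derivative of a smooth
`(k-1)`-form on `M` (for `k = 0`: forms that vanish on `M`). -/
def exactForms (M : TopologicalSpace.Opens E) : (k : ℕ) → Submodule ℝ (Form E k)
  | 0 =>
    { carrier := {α : E → E [⋀^Fin 0]→L[ℝ] ℝ | ∀ x ∈ M, α x = 0}
      zero_mem' := fun _ _ => rfl
      add_mem' := fun {α β} h₁ h₂ x hx => by
        change α x + β x = 0
        rw [h₁ x hx, h₂ x hx, add_zero]
      smul_mem' := fun c α h x hx => by
        change c • α x = 0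
        rw [h x hx, smul_zero] }
  | (k + 1) =>
    { carrier := {α : E → E [⋀^Fin (k + 1)]→L[ℝ] ℝ | ∃ θ : E → E [⋀^Fin k]→L[ℝ] ℝ,
        ContDiffOn ℝ ∞ θ M ∧ ∀ x ∈ M, extDeriv θ x = α x}
      zero_mem' := by
        exact ⟨0, contDiffOn_const, fun x _ => extDeriv_zero_form k x⟩
      add_mem' := by
        rintro α₁ α₂ ⟨θ₁, h₁, h₁'⟩ ⟨θ₂, h₂, h₂'⟩
        refine ⟨θ₁ + θ₂, h₁.add h₂, fun x hx => ?_⟩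
        have hM : (M : Set E) ∈ nhds x := M.isOpen.mem_nhds hx
        rw [extDeriv_add ((h₁.contDiffAt hM).differentiableAt (by simp))
          ((h₂.contDiffAt hM).differentiableAt (by simp)), h₁' x hx, h₂' x hx]
        rfl
      smul_mem' := by
        rintro c α ⟨θ, h, h'⟩
        refine ⟨c • θ, contDiffOn_const.smul h, fun x hx => ?_⟩
        rw [extDeriv_smul, h' x hx]
        rfl }

/-- The `k`-th de Rham cohomology `H^k_dR(M)` of an open set `M`: closed forms modulo exact
forms. (Two closed forms that agree on `M` are identified.) -/
abbrev Cohomology (M : TopologicalSpace.Opens E) (k : ℕ) : Type _ :=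
  closedForms M k ⧸ (exactForms M k).submoduleOf (closedForms M k)

end DeRham

/-! ### Linearized gravity on Minkowski spacetime -/

namespace LinearizedGravity

/-- Minkowski spacetime in Cartesian inertial coordinates `(x⁰, x¹, x², x³)`, `x⁰` being time. -/
abbrev Spacetime : Type := Fin 4 → ℝ

/-- Covariant tensor fields `h_ab`, given by their components. -/
abbrev TensorField₂ : Type := Spacetime → Fin 4 → Fin 4 → ℝ

/-- Covariant tensor fields `F_abc`, given by their components. -/
abbrev TensorField₃ : Type := Spacetime → Fin 4 → Fin 4 → Fin 4 → ℝ

/-- The Minkowski metric with signature `(+,-,-,-)`. The components `η_ab` and `η^ab` coincide. -/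
def η (a b : Fin 4) : ℝ := Matrix.diagonal ![1, -1, -1, -1] a b

/-- The totally antisymmetric symbol `ε^{abcd}` with `ε^{0123} = 1`: the determinant of the matrix
whose rows are the standard basis vectors number `a`, `b`, `c`, `d`. -/
def ε (a b c d : Fin 4) : ℝ :=
  (Matrix.det ((1 : Matrix (Fin 4) (Fin 4) ℤ).submatrix ![a, b, c, d] id) : ℤ)

/-- The partial derivative `∂_a f` of a function on `S`. On an open set `S` this is the usual
partial derivative; on a set such as `[t₀, t₁] × Y` with `Y` open, the derivative at a boundary
point is taken within `S` (one-sided in time). -/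
def partialDeriv (S : Set Spacetime) (a : Fin 4) (f : Spacetime → ℝ) (x : Spacetime) : ℝ :=
  fderivWithin ℝ f S x (Pi.single a 1)

/-- `∂_a h_bc`. -/
def d₁ (S : Set Spacetime) (h : TensorField₂) (a b c : Fin 4) : Spacetime → ℝ :=
  partialDeriv S a fun y => h y b c

/-- `∂_a ∂_b h_cd`. -/
def d₂ (S : Set Spacetime) (h : TensorField₂) (a b c d : Fin 4) : Spacetime → ℝ :=
  partialDeriv S a (d₁ S h b c d)

/-- The trace `h = h_a^a`. -/
def trace (h : TensorField₂) (x : Spacetime) : ℝ := ∑ a, ∑ b, η a b * h x a b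

/-- The divergence `∂_a h^a_b`. -/
def divergence (S : Set Spacetime) (h : TensorField₂) (x : Spacetime) (b : Fin 4) : ℝ :=
  ∑ a, ∑ c, η a c * d₁ S h a c b x

/-- The linearized Riemann tensor
`R_abcd = (1/2) (∂_bc h_ad + ∂_ad h_bc - ∂_ac h_bd - ∂_bd h_ac)`. -/
def riemann (S : Set Spacetime) (h : TensorField₂) (x : Spacetime) (a b c d : Fin 4) : ℝ :=
  (1 / 2) * (d₂ S h b c a d x + d₂ S h a d b c x - d₂ S h a c b d x - d₂ S h b d a c x)

/-- The linearized Ricci tensor `R_ab = η^{cd} R_acbd`. -/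
def ricci (S : Set Spacetime) (h : TensorField₂) (x : Spacetime) (a b : Fin 4) : ℝ :=
  ∑ c, ∑ d, η c d * riemann S h x a c b d

/-- The linearized Ricci scalar `R = η^{ab} R_ab`. -/
def scalarCurvature (S : Set Spacetime) (h : TensorField₂) (x : Spacetime) : ℝ :=
  ∑ a, ∑ b, η a b * ricci S h x a b

/-- The linearized Einstein tensor `G_ab = R_ab - (1/2) η_ab R`. -/
def einstein (S : Set Spacetime) (h : TensorField₂) (x : Spacetime) (a b : Fin 4) : ℝ :=
  ricci S h x a b - (1 / 2) * η a b * scalarCurvature S h x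

/-- The Fierz tensor `F_abc = (1/2) (∂_a h_bc - ∂_b h_ac + ∂_d h^d_a η_bc - ∂_d h^d_b η_ac
- (∂_a h) η_bc + (∂_b h) η_ac)`. -/
def fierz (S : Set Spacetime) (h : TensorField₂) : TensorField₃ := fun x a b c =>
  (1 / 2) * (d₁ S h a b c x - d₁ S h b a c x
    + divergence S h x a * η b c - divergence S h x b * η a c
    - partialDeriv S a (trace h) x * η b c + partialDeriv S b (trace h) x * η a c)

/-- The Hodge dual in the first two indices, `T̃^{ab}_c = (1/2) ε^{abmn} T_mnc`, with the indices
`a`, `b` lowered. -/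
def hodgeDual (T : TensorField₃) : TensorField₃ := fun x a b c =>
  ∑ p, ∑ q, η a p * η b q * ((1 / 2) * ∑ m, ∑ n, ε p q m n * T x m n c)

/-- `h_ab` is a smooth symmetric tensor field on `S` that satisfies the linearized Einstein
equations without source, `G_ab = 0`, on `S`. -/
structure IsVacuumSolutionOn (S : Set Spacetime) (h : TensorField₂) : Prop where
  smooth : ContDiffOn ℝ ∞ h S
  symm : ∀ x ∈ S, ∀ a b, h x a b = h x b a
  einstein_eq : ∀ x ∈ S, ∀ a b, einstein S h x a b = 0

/-- The TT (transverse traceless) gauge conditions on `S`: `∂_a h^{ab} = 0`, `h_a^a = 0` and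
`h_{a0} = 0` for all `a = 0, 1, 2, 3`. -/
structure IsTTGaugeOn (S : Set Spacetime) (h : TensorField₂) : Prop where
  divergence_eq : ∀ x ∈ S, ∀ b, divergence S h x b = 0
  trace_eq : ∀ x ∈ S, trace h x = 0
  time_eq : ∀ x ∈ S, ∀ a, h x a 0 = 0

/-- The source-free solution `h'` is a dual, on `S`, of the source-free solution `h`: the Fierz
tensor of `h'` is the Hodge dual of the Fierz tensor of `h`. -/
structure IsDualOn (S : Set Spacetime) (h h' : TensorField₂) : Prop where
  solution : IsVacuumSolutionOn S h
  solution' : IsVacuumSolutionOn S h'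
  fierz_eq : ∀ x ∈ S, ∀ a b c, fierz S h' x a b c = hodgeDual (fierz S h) x a b c

/-- The region `[t₀, t₁] × Y` of spacetime, where `Y` is a set of points of space. -/
def slab (t₀ t₁ : ℝ) (Y : Set (Fin 3 → ℝ)) : Set Spacetime :=
  {x | x 0 ∈ Set.Icc t₀ t₁ ∧ (fun i : Fin 3 => x i.succ) ∈ Y}

end LinearizedGravity

end

/-! In TT gauge the Fierz tensor is half the curl `∂_a h_bc - ∂_b h_ac` (`fierz_eq`), and the
Einstein tensor is a multiple of the wave operator (`einstein_eq_dalembertian`). So a TT field `h'`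
must be found whose curl is the Hodge dual of the curl of `h`; the field equations for `h'` then
follow.

Existence of a potential: for fixed `c` the dual of the curl is a closed two-form, since `h` is
divergence-free and solves the wave equation. By `H² = 0` it has a potential `τ_bc`. Because `h` is
also trace-free, the dual curl is cyclic, which makes the antisymmetric part of `τ` closed; a second
use of `H² = 0` yields a gradient `∂_b A_c` that symmetrises `τ` (`exists_symmetric_potential`).

Gauge fixing: adding a Hessian keeps both symmetry and curl. As `h_a0 = 0`, the covector `θ_b0` is
curl-free on `U`, hence a gradient `∂_b μ` by `H¹ = 0`, and the Hessian of `l` with `∂_0 l = -μ`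
removes it (`exists_temporal_gauge`). The curl is trace-free because `h` is symmetric, so the
gradient of the trace equals the divergence; in temporal gauge the trace is therefore static, and
the Hessian of a static solution of Poisson's equation cancels it (`exists_traceless_gauge`). Zero
trace then forces zero divergence. Finally the divergence of the new curl is both the wave operator
on `h'` and the divergence of a dual curl, which vanishes identically.

Cutoffs equal to `1` on the slab make the data for `l` and for Poisson's equation global, so neither
the shape nor the topology of the spatial domain plays a role. -/

noncomputable section

namespace LinearizedGravity

/-! ### Partial derivatives of smooth functions -/

/-- The coordinate partial derivative `∂_a f` on the whole of spacetime. -/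
def pderiv (a : Fin 4) (f : Spacetime → ℝ) (x : Spacetime) : ℝ :=
  fderiv ℝ f x (Pi.single a 1)

section PartialDerivatives

variable {f g : Spacetime → ℝ} {S U : Set Spacetime} {x : Spacetime}

theorem pderiv_neg (a : Fin 4) : pderiv a (fun y => -f y) x = -pderiv a f x := by
  simp [pderiv, fderiv_fun_neg]

theorem pderiv_zero (a : Fin 4) : pderiv a (fun _ => (0 : ℝ)) x = 0 := by
  simp [pderiv]

theorem pderiv_add (a : Fin 4) (hf : DifferentiableAt ℝ f x) (hg : DifferentiableAt ℝ g x) :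
    pderiv a (fun y => f y + g y) x = pderiv a f x + pderiv a g x := by
  simp [pderiv, fderiv_fun_add hf hg]

theorem pderiv_sub (a : Fin 4) (hf : DifferentiableAt ℝ f x) (hg : DifferentiableAt ℝ g x) :
    pderiv a (fun y => f y - g y) x = pderiv a f x - pderiv a g x := by
  simp [pderiv, fderiv_fun_sub hf hg]

theorem differentiableAt_of_contDiffOn (hf : ContDiffOn ℝ ∞ f U) (hU : IsOpen U) (hx : x ∈ U) :
    DifferentiableAt ℝ f x :=
  (hf.contDiffAt (hU.mem_nhds hx)).differentiableAt (by simp)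

theorem contDiffOn_pderiv (hf : ContDiffOn ℝ ∞ f U) (hU : IsOpen U) (a : Fin 4) :
    ContDiffOn ℝ ∞ (pderiv a f) U :=
  (hf.fderiv_of_isOpen hU (m := ∞) (by simp)).clm_apply contDiffOn_const

theorem pderiv_comm (hf : ContDiffOn ℝ ∞ f U) (hU : IsOpen U) (hx : x ∈ U) (a b : Fin 4) :
    pderiv a (pderiv b f) x = pderiv b (pderiv a f) x := by
  have hc := hf.contDiffAt (hU.mem_nhds hx)
  have hd : DifferentiableAt ℝ (fderiv ℝ f) x :=
    ((hf.fderiv_of_isOpen hU (m := ∞) (by simp)).contDiffAt (hU.mem_nhds hx)).differentiableAt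
      (by simp)
  have key : ∀ a b : Fin 4, pderiv a (pderiv b f) x =
      fderiv ℝ (fderiv ℝ f) x (Pi.single a 1) (Pi.single b 1) := by
    intro a b
    change fderiv ℝ (fun y => fderiv ℝ f y (Pi.single b 1)) x (Pi.single a 1) = _
    rw [fderiv_clm_apply hd (differentiableAt_const _)]
    simp
  rw [key, key]
  exact hc.isSymmSndFDerivAt (by simp; exact WithTop.coe_le_coe.2 le_top) _ _

/-- The constructed fields are smooth on an open neighbourhood of the slab, so the one-sided
derivatives of the statement agree with ordinary ones; all calculus is then done with `pderiv`. -/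
theorem partialDeriv_eq_pderiv (hS : UniqueDiffOn ℝ S) (hx : x ∈ S) (hf : DifferentiableAt ℝ f x)
    (a : Fin 4) : partialDeriv S a f x = pderiv a f x := by
  rw [partialDeriv, hf.fderivWithin (hS x hx), pderiv]

/-- Partial derivatives at points of `S` depend only on the values on `S`. -/
theorem pderiv_congr (hS : UniqueDiffOn ℝ S) (hx : x ∈ S) (hf : DifferentiableAt ℝ f x)
    (hg : DifferentiableAt ℝ g x) (h : Set.EqOn f g S) (a : Fin 4) :
    pderiv a f x = pderiv a g x := by
  rw [← partialDeriv_eq_pderiv hS hx hf, ← partialDeriv_eq_pderiv hS hx hg, partialDeriv,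
    partialDeriv, fderivWithin_congr h (h hx)]

theorem pderiv_eq_zero (hS : UniqueDiffOn ℝ S) (hx : x ∈ S) (hf : DifferentiableAt ℝ f x)
    (h : ∀ y ∈ S, f y = 0) (a : Fin 4) : pderiv a f x = 0 := by
  rw [pderiv_congr hS hx hf (differentiableAt_const 0) h, pderiv_zero]

end PartialDerivatives

/-! ### Potentials in components -/

section Potentials

open DeRham TopologicalSpace

/-- The differential one-form with components `A_a`. -/
def oneForm (A : Fin 4 → ℝ) : Spacetime [⋀^Fin 1]→L[ℝ] ℝ :=
  ∑ a, A a • ContinuousAlternatingMap.ofSubsingleton ℝ Spacetime ℝ (0 : Fin 1)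
    (ContinuousLinearMap.proj a)

theorem oneForm_apply (A : Fin 4 → ℝ) (v : Fin 1 → Spacetime) :
    oneForm A v = ∑ a, A a * v 0 a := by
  simp [oneForm, ContinuousAlternatingMap.sum_apply]

/-- The differential two-form with components `B_ab - B_ba`. -/
def twoForm (B : Fin 4 → Fin 4 → ℝ) : Spacetime [⋀^Fin 2]→L[ℝ] ℝ :=
  ∑ a, ∑ b, B a b • ContinuousAlternatingMap.alternatizeUncurryFin
    ((ContinuousLinearMap.proj a : Spacetime →L[ℝ] ℝ).smulRight
      (ContinuousAlternatingMap.ofSubsingleton ℝ Spacetime ℝ (0 : Fin 1)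
        (ContinuousLinearMap.proj b)))

theorem twoForm_apply (B : Fin 4 → Fin 4 → ℝ) (v : Fin 2 → Spacetime) :
    twoForm B v = ∑ a, ∑ b, B a b * (v 0 a * v 1 b - v 1 a * v 0 b) := by
  simp [twoForm, ContinuousAlternatingMap.sum_apply,
    ContinuousAlternatingMap.alternatizeUncurryFin_apply, Fin.removeNth, sub_eq_add_neg]

theorem twoForm_apply_single (B : Fin 4 → Fin 4 → ℝ) (v : Fin 2 → Spacetime) (a b : Fin 4)
    (h₀ : v 0 = Pi.single a 1) (h₁ : v 1 = Pi.single b 1) :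
    twoForm B v = B a b - B b a := by
  simp [twoForm_apply, h₀, h₁, Pi.single_apply, mul_sub, Finset.sum_sub_distrib]

theorem oneForm_apply_single (A : Fin 4 → ℝ) (v : Fin 1 → Spacetime) (a : Fin 4)
    (h₀ : v 0 = Pi.single a 1) : oneForm A v = A a := by
  simp [oneForm_apply, h₀, Pi.single_apply]

theorem continuousAlternatingMap_ext_single {n : ℕ} {α β : Spacetime [⋀^Fin n]→L[ℝ] ℝ}
    (h : ∀ s : Fin n → Fin 4, α (fun i => Pi.single (s i) 1) = β (fun i => Pi.single (s i) 1)) :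
    α = β := by
  refine ContinuousAlternatingMap.toAlternatingMap_injective
    (Module.Basis.ext_alternating (Pi.basisFun ℝ (Fin 4)) fun s _ => ?_)
  simpa using h s

theorem exists_contDiffOn_of_closed {M : Opens Spacetime} {k : ℕ}
    (hM : Subsingleton (Cohomology M (k + 1))) {σ : Spacetime → Spacetime [⋀^Fin (k + 1)]→L[ℝ] ℝ}
    (hσ : ContDiffOn ℝ ∞ σ M) (hc : ∀ x ∈ M, extDeriv σ x = 0) :
    ∃ θ : Spacetime → Spacetime [⋀^Fin k]→L[ℝ] ℝ, ContDiffOn ℝ ∞ θ M ∧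
      ∀ x ∈ M, extDeriv θ x = σ x := by
  let α : closedForms M (k + 1) := ⟨σ, hσ, hc⟩
  have := (Submodule.Quotient.mk_eq_zero _).1
    (Subsingleton.elim (Submodule.Quotient.mk α : Cohomology M (k + 1)) 0)
  exact this

theorem extDeriv_apply_single {k : ℕ} {σ : Spacetime → Spacetime [⋀^Fin k]→L[ℝ] ℝ}
    {x : Spacetime} (hσ : DifferentiableAt ℝ σ x) (s : Fin (k + 1) → Fin 4) :
    extDeriv σ x (fun i => Pi.single (s i) 1) =
      ∑ i, (-1) ^ i.val * pderiv (s i) (fun y => σ y fun j => Pi.single (s (i.succAbove j)) 1) x := by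
  rw [extDeriv_apply hσ]
  simp only [zsmul_eq_mul]
  push_cast
  rfl

theorem contDiffOn_form_apply {k : ℕ} {σ : Spacetime → Spacetime [⋀^Fin k]→L[ℝ] ℝ}
    {M : Set Spacetime} (hσ : ContDiffOn ℝ ∞ σ M) (v : Fin k → Spacetime) :
    ContDiffOn ℝ ∞ (fun x => σ x v) M :=
  (ContinuousAlternatingMap.apply ℝ Spacetime ℝ v).contDiff.comp_contDiffOn hσ

/-- If `H² = 0`, an antisymmetric closed field `B_ab` is the curl of a covector field. -/
theorem exists_covector_potential {M : Opens Spacetime} (hM : Subsingleton (Cohomology M 2))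
    {B : Spacetime → Fin 4 → Fin 4 → ℝ}
    (hB : ∀ a b, ContDiffOn ℝ ∞ (fun x => B x a b) M)
    (hanti : ∀ x a b, B x a b = -B x b a)
    (hclosed : ∀ x ∈ M, ∀ a b c, pderiv a (fun y => B y b c) x + pderiv b (fun y => B y c a) x
      + pderiv c (fun y => B y a b) x = 0) :
    ∃ A : Spacetime → Fin 4 → ℝ, (∀ a, ContDiffOn ℝ ∞ (fun x => A x a) M) ∧
      ∀ x ∈ M, ∀ a b, pderiv a (fun y => A y b) x - pderiv b (fun y => A y a) x = B x a b := by
  -- `twoForm` antisymmetrises without normalising, so an antisymmetric `B` would come out doubled.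
  set σ : Spacetime → Spacetime [⋀^Fin 2]→L[ℝ] ℝ := fun x => (1 / 2 : ℝ) • twoForm (B x) with hσ
  have happ : ∀ (a b : Fin 4) (v : Fin 2 → Spacetime), v 0 = Pi.single a 1 → v 1 = Pi.single b 1 →
      (fun x => σ x v) = fun x => B x a b := by
    intro a b v h₀ h₁
    ext x
    simp only [hσ, ContinuousAlternatingMap.smul_apply, smul_eq_mul]
    rw [twoForm_apply_single _ _ a b h₀ h₁, hanti x b a]
    ring
  have hsm : ContDiffOn ℝ ∞ σ M := by
    have h : ContDiffOn ℝ ∞ (fun x => twoForm (B x)) M :=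
      ContDiffOn.sum fun a _ => ContDiffOn.sum fun b _ => (hB a b).smul contDiffOn_const
    exact h.const_smul (1 / 2 : ℝ)
  have hdiff : ∀ x ∈ M, DifferentiableAt ℝ σ x := fun x hx =>
    (hsm.contDiffAt (M.isOpen.mem_nhds hx)).differentiableAt (by simp)
  obtain ⟨θ, hθ, hθσ⟩ := exists_contDiffOn_of_closed hM hsm fun x hx => by
    refine continuousAlternatingMap_ext_single fun s => ?_
    rw [extDeriv_apply_single (hdiff x hx)]
    rw [Fin.sum_univ_three, happ (s 1) (s 2) _ rfl rfl, happ (s 0) (s 2) _ rfl rfl, happ (s 0) (s 1) _ rfl rfl]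
    have h := hclosed x hx (s 0) (s 1) (s 2)
    rw [show (fun y => B y (s 2) (s 0)) = fun y => -B y (s 0) (s 2) from
      funext fun y => hanti y _ _, pderiv_neg] at h
    change _ = (0 : ℝ)
    norm_num
    linarith
  refine ⟨fun x a => θ x fun _ => Pi.single a 1, fun a => contDiffOn_form_apply hθ _,
    fun x hx a b => ?_⟩
  have h := congrArg (fun α : Spacetime [⋀^Fin 2]→L[ℝ] ℝ =>
    α fun i => Pi.single ((![a, b] : Fin 2 → Fin 4) i) 1) (hθσ x hx)
  beta_reduce at h
  rw [extDeriv_apply_single ((hθ.contDiffAt (M.isOpen.mem_nhds hx)).differentiableAt (by simp)),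
    congrFun (happ a b _ rfl rfl) x, Fin.sum_univ_two] at h
  rw [← h]
  have e₀ : (fun j : Fin 1 => (Pi.single ((![a, b] : Fin 2 → Fin 4) ((0 : Fin 2).succAbove j)) 1 :
      Spacetime)) = fun _ => Pi.single b 1 := by
    ext j; fin_cases j; rfl
  have e₁ : (fun j : Fin 1 => (Pi.single ((![a, b] : Fin 2 → Fin 4) ((1 : Fin 2).succAbove j)) 1 :
      Spacetime)) = fun _ => Pi.single a 1 := by
    ext j; fin_cases j; rfl
  rw [e₀, e₁]
  simp [sub_eq_add_neg]

/-- If `H¹ = 0`, a curl-free covector field is a gradient. -/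
theorem exists_scalar_potential {M : Opens Spacetime} (hM : Subsingleton (Cohomology M 1))
    {A : Spacetime → Fin 4 → ℝ} (hA : ∀ a, ContDiffOn ℝ ∞ (fun x => A x a) M)
    (hclosed : ∀ x ∈ M, ∀ a b, pderiv a (fun y => A y b) x - pderiv b (fun y => A y a) x = 0) :
    ∃ μ : Spacetime → ℝ, ContDiffOn ℝ ∞ μ M ∧ ∀ x ∈ M, ∀ a, pderiv a μ x = A x a := by
  set σ : Spacetime → Spacetime [⋀^Fin 1]→L[ℝ] ℝ := fun x => oneForm (A x) with hσ
  have happ : ∀ (a : Fin 4) (v : Fin 1 → Spacetime), v 0 = Pi.single a 1 →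
      (fun x => σ x v) = fun x => A x a := fun a v h₀ =>
    funext fun x => oneForm_apply_single (A x) v a h₀
  have hsm : ContDiffOn ℝ ∞ σ M :=
    ContDiffOn.sum fun a _ => (hA a).smul contDiffOn_const
  obtain ⟨θ, hθ, hθσ⟩ := exists_contDiffOn_of_closed hM hsm fun x hx => by
    refine continuousAlternatingMap_ext_single fun s => ?_
    rw [extDeriv_apply_single
      ((hsm.contDiffAt (M.isOpen.mem_nhds hx)).differentiableAt (by simp))]
    rw [Fin.sum_univ_two, happ (s 1) _ rfl, happ (s 0) _ rfl]
    have h := hclosed x hx (s 0) (s 1)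
    change _ = (0 : ℝ)
    norm_num
    linarith
  refine ⟨fun x => θ x fun j => j.elim0, contDiffOn_form_apply hθ _, fun x hx a => ?_⟩
  have h := congrArg (fun α : Spacetime [⋀^Fin 1]→L[ℝ] ℝ =>
    α fun i => Pi.single ((![a] : Fin 1 → Fin 4) i) 1) (hθσ x hx)
  beta_reduce at h
  rw [extDeriv_apply_single ((hθ.contDiffAt (M.isOpen.mem_nhds hx)).differentiableAt (by simp)),
    congrFun (happ a _ rfl) x, Fin.sum_univ_one] at h
  rw [← h, show (fun j : Fin 0 => (Pi.single ((![a] : Fin 1 → Fin 4) ((0 : Fin 1).succAbove j)) 1 :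
      Spacetime)) = fun j => j.elim0 from funext fun j => j.elim0]
  simp

end Potentials

/-! ### Poisson's equation and time primitives for compactly supported data -/

open MeasureTheory FourierTransform SchwartzMap in
/-- On a three-dimensional space, a Schwartz function divided by `‖ξ‖ ^ 2` has moments of all
orders. -/
theorem integrable_norm_pow_mul_div_sq {V : Type*} [NormedAddCommGroup V] [InnerProductSpace ℝ V]
    [FiniteDimensional ℝ V] [MeasurableSpace V] [BorelSpace V] (hV : Module.finrank ℝ V = 3)
    (φ : SchwartzMap V ℂ) (n : ℕ) :
    Integrable (fun ξ : V => ‖ξ‖ ^ n * ‖((‖ξ‖ ^ 2 : ℝ)⁻¹ : ℂ) * φ ξ‖) := by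
  have : Nontrivial V := Module.nontrivial_of_finrank_pos (R := ℝ) (by omega)
  -- In polar coordinates the Jacobian `r ^ 2` of dimension three cancels the singularity at the
  -- origin.
  have hw : Integrable (fun ξ : V => (‖ξ‖ ^ 2)⁻¹ * (1 + ‖ξ‖ ^ 2)⁻¹) := by
    rw [integrable_fun_norm_addHaar volume (f := fun r : ℝ => (r ^ 2)⁻¹ * (1 + r ^ 2)⁻¹), hV]
    refine (integrable_inv_one_add_sq.integrableOn (s := Set.Ioi (0 : ℝ))).congr_fun
      (fun r hr => ?_) measurableSet_Ioi
    have : r ≠ 0 := ne_of_gt hr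
    simp only [smul_eq_mul]
    field_simp
  obtain ⟨C₁, h₁⟩ := φ.decay n 0
  obtain ⟨C₂, h₂⟩ := φ.decay (n + 2) 0
  refine (hw.const_mul (C₁ + C₂)).mono' ?_ (.of_forall fun ξ => ?_)
  · have := φ.continuous.measurable
    fun_prop
  · have h₁ := h₁.2 ξ
    have h₂ := h₂.2 ξ
    simp only [norm_iteratedFDeriv_zero] at h₁ h₂
    rw [Real.norm_of_nonneg (by positivity), norm_mul]
    have e : ‖((‖ξ‖ ^ 2 : ℝ)⁻¹ : ℂ)‖ = (‖ξ‖ ^ 2)⁻¹ := by simp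
    have h0 : 0 ≤ (‖ξ‖ ^ 2)⁻¹ := by positivity
    have h1 : 0 < 1 + ‖ξ‖ ^ 2 := by positivity
    rw [e]
    calc _ = (‖ξ‖ ^ 2)⁻¹ * (‖ξ‖ ^ n * ‖φ ξ‖) := by ring
      _ ≤ (‖ξ‖ ^ 2)⁻¹ * ((C₁ + C₂) * (1 + ‖ξ‖ ^ 2)⁻¹) := by
        refine mul_le_mul_of_nonneg_left ?_ h0
        rw [← div_eq_mul_inv, le_div_iff₀ h1]
        calc _ = ‖ξ‖ ^ n * ‖φ ξ‖ + ‖ξ‖ ^ (n + 2) * ‖φ ξ‖ := by ring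
          _ ≤ _ := add_le_add h₁ h₂
      _ = _ := by ring

open MeasureTheory FourierTransform in
/-- Differentiation of a Fourier transform in a direction. -/
theorem fderiv_fourier_apply {V : Type*} [NormedAddCommGroup V] [InnerProductSpace ℝ V]
    [FiniteDimensional ℝ V] [MeasurableSpace V] [BorelSpace V] {g : V → ℂ}
    (h₀ : Integrable g) (h₁ : Integrable fun ξ => ‖ξ‖ * ‖g ξ‖) (x v : V) :
    fderiv ℝ (𝓕 g) x v = 𝓕 (fun ξ => -(2 * Real.pi * Complex.I) * (inner ℝ ξ v * g ξ)) x := by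
  rw [Real.fderiv_fourier h₀ h₁]
  rw [Real.fourier_continuousLinearMap_apply]
  · congr 1
  · exact ((h₁.const_mul (2 * Real.pi * ‖innerSL (E := V) ℝ‖))).mono'
      h₀.1.fourierSMulRight (.of_forall fun ξ =>
        (VectorFourier.norm_fourierSMulRight_le _ _ _).trans_eq (by ring))

open MeasureTheory FourierTransform in
/-- Poisson's equation with a Schwartz right-hand side has a smooth solution on a
three-dimensional space. -/
theorem exists_poisson_schwartz {V : Type*} [NormedAddCommGroup V] [InnerProductSpace ℝ V]
    [FiniteDimensional ℝ V] [MeasurableSpace V] [BorelSpace V] (b : OrthonormalBasis (Fin 3) ℝ V)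
    (φ : SchwartzMap V ℂ) :
    ∃ w : V → ℂ, ContDiff ℝ ∞ w ∧
      ∀ x, ∑ i, fderiv ℝ (fun y => fderiv ℝ w y (b i)) x (b i) = φ x := by
  have hV : Module.finrank ℝ V = 3 := by simpa using Module.finrank_eq_card_basis b.toBasis
  have : Nontrivial V := Module.nontrivial_of_finrank_pos (R := ℝ) (by omega)
  set ψ : SchwartzMap V ℂ := 𝓕⁻ φ with hψ
  set c : ℂ := -(2 * Real.pi * Complex.I) with hc
  have hc0 : c ≠ 0 := by simp [hc, Real.pi_ne_zero]
  -- All moments of `g` are finite, so `𝓕 g` is smooth. Two derivatives along `b i` multiply `g` by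
  -- `c ^ 2 * ⟪ξ, b i⟫ ^ 2`; these sum to `c ^ 2 * ‖ξ‖ ^ 2`, whence the normalisation `(c ^ 2)⁻¹` of
  -- the solution.
  set g : V → ℂ := fun ξ => ((‖ξ‖ ^ 2 : ℝ)⁻¹ : ℂ) * ψ ξ with hg
  have hgm : AEStronglyMeasurable g := by
    have := ψ.continuous.measurable
    exact Measurable.aestronglyMeasurable (by fun_prop)
  have hint : ∀ n : ℕ, Integrable fun ξ : V => ‖ξ‖ ^ n * ‖g ξ‖ :=
    integrable_norm_pow_mul_div_sq hV ψ
  have h₀ : Integrable g := by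
    have := hint 0
    simp only [pow_zero, one_mul] at this
    exact (integrable_norm_iff hgm).1 this
  have h₁ : Integrable fun ξ : V => ‖ξ‖ * ‖g ξ‖ := by simpa using hint 1
  have hmul : ∀ (f : V → ℂ) (v : V), AEStronglyMeasurable f →
      ∀ n : ℕ, (Integrable fun ξ : V => ‖ξ‖ ^ (n + 1) * ‖f ξ‖) →
      Integrable fun ξ => ‖ξ‖ ^ n * ‖c * (inner ℝ ξ v * f ξ)‖ := by
    intro f v hf n hn
    refine (hn.const_mul (‖c‖ * ‖v‖)).mono' (by fun_prop) (.of_forall fun ξ => ?_)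
    rw [Real.norm_of_nonneg (by positivity), norm_mul, norm_mul, Complex.norm_real]
    calc ‖ξ‖ ^ n * (‖c‖ * (‖inner ℝ ξ v‖ * ‖f ξ‖))
        ≤ ‖ξ‖ ^ n * (‖c‖ * ((‖ξ‖ * ‖v‖) * ‖f ξ‖)) := by
          gcongr
          exact norm_inner_le_norm ξ v
      _ = _ := by ring
  have hmeas : ∀ v : V, AEStronglyMeasurable fun ξ => c * (inner ℝ ξ v * g ξ) := fun v => by
    fun_prop
  have hg₀ : ∀ v : V, Integrable fun ξ => c * (inner ℝ ξ v * g ξ) := fun v => by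
    have := hmul g v hgm 0 (by simpa using h₁)
    simp only [pow_zero, one_mul] at this
    exact (integrable_norm_iff (hmeas v)).1 this
  have hg₁ : ∀ v : V, Integrable fun ξ => ‖ξ‖ * ‖c * (inner ℝ ξ v * g ξ)‖ := fun v => by
    simpa using hmul g v hgm 1 (hint 2)
  have hg₂ : ∀ v : V, Integrable fun ξ => c * (inner ℝ ξ v * (c * (inner ℝ ξ v * g ξ))) :=
    fun v => by
    have := hmul _ v (hmeas v) 0 (by simpa using hg₁ v)
    simp only [pow_zero, one_mul] at this
    exact (integrable_norm_iff (by fun_prop)).1 this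
  have hw : ContDiff ℝ ∞ (𝓕 g) := Real.contDiff_fourier (N := ⊤) fun n _ => hint n
  refine ⟨fun x => (c ^ 2)⁻¹ * 𝓕 g x, contDiff_const.mul hw, fun x => ?_⟩
  have hd : ∀ i, fderiv ℝ (fun y => fderiv ℝ (fun x => (c ^ 2)⁻¹ * 𝓕 g x) y (b i)) x (b i) =
      (c ^ 2)⁻¹ * 𝓕 (fun ξ => c * (inner ℝ ξ (b i) * (c * (inner ℝ ξ (b i) * g ξ)))) x := by
    intro i
    have e : (fun y => fderiv ℝ (fun x => (c ^ 2)⁻¹ * 𝓕 g x) y (b i)) =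
        fun y => (c ^ 2)⁻¹ * 𝓕 (fun ξ => c * (inner ℝ ξ (b i) * g ξ)) y := by
      ext y
      rw [fderiv_const_mul (hw.differentiable (by simp) y)]
      simp [fderiv_fourier_apply h₀ h₁, hc]
    rw [e, fderiv_const_mul (Real.differentiable_fourier (hg₀ _) (hg₁ _) x)]
    rw [← fderiv_fourier_apply (hg₀ _) (hg₁ _)]
    rfl
  simp only [hd, ← Finset.mul_sum]
  have hφ : φ x = 𝓕 (ψ : V → ℂ) x := by
    rw [← SchwartzMap.fourier_coe, hψ, FourierTransform.fourier_fourierInv_eq]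
  rw [hφ, inv_mul_eq_iff_eq_mul₀ (by positivity)]
  simp only [Real.fourier_eq]
  rw [← integral_finsetSum, ← integral_const_mul]
  · refine integral_congr_ae ?_
    -- At the origin `0⁻¹ = 0` spoils the cancellation of `‖ξ‖ ^ 2`, but only on a null set.
    have h0 : ∀ᵐ ξ : V, ξ ≠ 0 := by simp [ae_iff]
    filter_upwards [h0] with ξ hξ
    have hs : ∑ i, ((inner ℝ ξ (b i) : ℝ) : ℂ) ^ 2 = ((‖ξ‖ ^ 2 : ℝ) : ℂ) := by
      rw [← b.sum_sq_norm_inner_left ξ]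
      push_cast
      refine Finset.sum_congr rfl fun i _ => ?_
      rw [← Complex.ofReal_pow, ← Complex.ofReal_pow, Real.norm_eq_abs, sq_abs]
    have hn : ((‖ξ‖ ^ 2 : ℝ) : ℂ) ≠ 0 := by
      simpa using hξ
    simp only [Circle.smul_def, smul_eq_mul, hg]
    calc _ = ((Real.fourierChar (-inner ℝ ξ x) : Circle) : ℂ) * c ^ 2 *
          (∑ i, ((inner ℝ ξ (b i) : ℝ) : ℂ) ^ 2) * ((‖ξ‖ ^ 2 : ℝ)⁻¹ : ℂ) * ψ ξ := by
          rw [Finset.mul_sum, Finset.sum_mul, Finset.sum_mul]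
          exact Finset.sum_congr rfl fun i _ => by ring
      _ = _ := by
          rw [hs]
          field_simp
  · intro i _
    exact (Real.fourierIntegral_convergent_iff x).2 (hg₂ (b i))

/-- Poisson's equation in three dimensions with a smooth compactly supported right-hand side. -/
theorem exists_poisson {f : (Fin 3 → ℝ) → ℝ} (hf : ContDiff ℝ ∞ f) (hc : HasCompactSupport f) :
    ∃ u : (Fin 3 → ℝ) → ℝ, ContDiff ℝ ∞ u ∧ ∀ x,
      ∑ i, fderiv ℝ (fun y => fderiv ℝ u y (Pi.single i 1)) x (Pi.single i 1) = f x := by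
  -- The Fourier argument needs an inner product, which the sup-normed `Fin 3 → ℝ` does not have. As
  -- `f` is real, the real part of the complex solution suffices.
  let L := EuclideanSpace.equiv (Fin 3) ℝ
  have hF : ContDiff ℝ ∞ fun y : EuclideanSpace ℝ (Fin 3) => ((f (L y) : ℝ) : ℂ) :=
    Complex.ofRealCLM.contDiff.comp (hf.comp L.contDiff)
  have hFc : HasCompactSupport fun y : EuclideanSpace ℝ (Fin 3) => ((f (L y) : ℝ) : ℂ) :=
    (hc.comp_homeomorph L.toHomeomorph).comp_left (g := ((↑) : ℝ → ℂ)) rfl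
  obtain ⟨w, hw, hwf⟩ := exists_poisson_schwartz (EuclideanSpace.basisFun (Fin 3) ℝ)
    (hFc.toSchwartzMap hF)
  have hd : ∀ (v : EuclideanSpace ℝ (Fin 3) → ℂ) (_ : Differentiable ℝ v)
      (x a : Fin 3 → ℝ), fderiv ℝ (fun x => (v (L.symm x)).re) x a =
        (fderiv ℝ v (L.symm x) (L.symm a)).re := by
    intro v hv x a
    have h₁ : HasFDerivAt (fun x => v (L.symm x))
        ((fderiv ℝ v (L.symm x)).comp (L.symm : (Fin 3 → ℝ) →L[ℝ] _)) x :=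
      (hv (L.symm x)).hasFDerivAt.comp x L.symm.hasFDerivAt
    have h₂ := Complex.reCLM.hasFDerivAt.comp x h₁
    rw [show (fun x => (v (L.symm x)).re) = Complex.reCLM ∘ fun x => v (L.symm x) from rfl,
      h₂.fderiv]
    rfl
  refine ⟨fun x => (w (L.symm x)).re,
    Complex.reCLM.contDiff.comp (hw.comp L.symm.contDiff), fun x => ?_⟩
  have hs : ∀ i : Fin 3, L.symm (Pi.single i 1) = EuclideanSpace.basisFun (Fin 3) ℝ i := by
    intro i
    rw [EuclideanSpace.basisFun_apply]
    rfl
  have hw' : ∀ e, ContDiff ℝ ∞ fun y => fderiv ℝ w y e := fun e =>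
    (hw.fderiv_right (m := ∞) (by simp)).clm_apply contDiff_const
  have key := congrArg Complex.re (hwf (L.symm x))
  rw [Complex.re_sum] at key
  have hr : (hFc.toSchwartzMap hF (L.symm x)).re = f x := by
    change ((f (L (L.symm x)) : ℝ) : ℂ).re = f x
    simp
  rw [← hr, ← key]
  refine Finset.sum_congr rfl fun i _ => ?_
  simp only [hd w (hw.differentiable (by simp)), hs]
  rw [hd (fun y => fderiv ℝ w y _) ((hw' _).differentiable (by simp)), hs]

open MeasureTheory in
/-- A smooth compactly supported function on spacetime has a smooth primitive in time. -/
theorem exists_time_primitive {g : Spacetime → ℝ} (hg : ContDiff ℝ ∞ g)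
    (hc : HasCompactSupport g) :
    ∃ l : Spacetime → ℝ, ContDiff ℝ ∞ l ∧ ∀ x, pderiv 0 l x = g x := by
  -- Convolving with the Heaviside function in time integrates `g` from `-∞` to `x 0`; smoothness in
  -- all variables comes from the compactly supported factor.
  set H : ℝ → ℝ := (Set.Ici (0 : ℝ)).indicator fun _ => 1 with hH
  have hHint : LocallyIntegrable H volume :=
    (locallyIntegrable_const (1 : ℝ)).indicator measurableSet_Ici
  set G : Spacetime → ℝ → ℝ := fun x s => g (Function.update x 0 s) with hG
  have hupd : ContDiff ℝ ∞ fun p : Spacetime × ℝ => Function.update p.1 0 p.2 := by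
    refine contDiff_pi.2 fun i => ?_
    by_cases hi : i = 0
    · subst hi
      simpa using contDiff_snd
    · simp only [Function.update_of_ne hi]
      exact (contDiff_apply ℝ ℝ i).comp contDiff_fst
  have hGsm : ContDiff ℝ ∞ fun p : Spacetime × ℝ => G p.1 p.2 := hg.comp hupd
  have hGx : ∀ x, ContDiff ℝ ∞ (G x) := fun x => hGsm.comp (contDiff_prodMk_right x)
  set k : Set ℝ := (fun y : Spacetime => y 0) '' tsupport g with hk
  have hkc : IsCompact k := hc.isCompact.image (continuous_apply 0)
  have hGk : ∀ x s, s ∉ k → G x s = 0 := by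
    intro x s hs
    by_contra hne
    exact hs ⟨Function.update x 0 s, subset_tsupport _ hne, by simp⟩
  have hGc : ∀ x, HasCompactSupport (G x) := fun x => HasCompactSupport.intro hkc (hGk x)
  set L := ContinuousLinearMap.mul ℝ ℝ
  set l : Spacetime → ℝ := fun x => (convolution H (G x) L volume) (x 0) with hl
  have hlsm : ContDiff ℝ ∞ l := by
    rw [← contDiffOn_univ]
    exact contDiffOn_convolution_right_with_param_comp (n := ⊤) L
      (contDiff_apply ℝ ℝ (0 : Fin 4)).contDiffOn isOpen_univ hkc (fun x s _ => hGk x s) hHint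
      hGsm.contDiffOn
  refine ⟨l, hlsm, fun x => ?_⟩
  have hline : ∀ r : ℝ, l (x + r • Pi.single 0 1) = (convolution H (G x) L volume) (x 0 + r) := by
    intro r
    have : G (x + r • Pi.single 0 1) = G x := by
      ext s
      simp only [hG]
      congr 1
      ext i
      by_cases hi : i = 0
      · subst hi; simp
      · simp [hi]
    simp [hl, this]
  have hd : HasDerivAt (convolution H (G x) L volume)
      ((convolution H (deriv (G x)) L volume) (x 0)) (x 0) :=
    (hGc x).hasDerivAt_convolution_right L hHint ((hGx x).of_le (by simp)) (x 0)
  have hval : (convolution H (deriv (G x)) L volume) (x 0) = g x := by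
    rw [convolution_eq_swap]
    have : ∀ t, L (H (x 0 - t)) (deriv (G x) t) =
        (Set.Iic (x 0)).indicator (deriv (G x)) t := by
      intro t
      by_cases ht : t ≤ x 0 <;> simp [L, hH, Set.indicator, ht]
    simp only [this]
    rw [integral_indicator measurableSet_Iic,
      (hGc x).integral_Iic_deriv_eq ((hGx x).of_le (by simp))]
    simp [hG]
  have h₁ : lineDeriv ℝ l x (Pi.single 0 1) = g x := by
    rw [← hval]
    refine HasDerivAt.deriv ?_
    simp only [hline]
    have := hd
    rw [← add_zero (x 0)] at this
    simpa using this.comp_const_add (x 0) 0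
  rw [← h₁, pderiv, DifferentiableAt.lineDeriv_eq_fderiv]
  exact hlsm.differentiable (by simp) x

/-- Poisson's equation on spacetime for time-independent data. -/
theorem exists_static_poisson {f : (Fin 3 → ℝ) → ℝ} (hf : ContDiff ℝ ∞ f)
    (hc : HasCompactSupport f) :
    ∃ u : Spacetime → ℝ, ContDiff ℝ ∞ u ∧ (∀ x, pderiv 0 u x = 0) ∧ ∀ x,
      pderiv 1 (pderiv 1 u) x + pderiv 2 (pderiv 2 u) x + pderiv 3 (pderiv 3 u) x =
        f fun i => x i.succ := by
  obtain ⟨v, hv, hvf⟩ := exists_poisson hf hc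
  let P : Spacetime →L[ℝ] (Fin 3 → ℝ) :=
    ContinuousLinearMap.pi fun i => ContinuousLinearMap.proj i.succ
  have hP : ∀ w : (Fin 3 → ℝ) → ℝ, ContDiff ℝ ∞ w → ∀ x a,
      pderiv a (fun y => w (P y)) x = fderiv ℝ w (P x) (P (Pi.single a 1)) := by
    intro w hw x a
    have : HasFDerivAt (fun y => w (P y)) ((fderiv ℝ w (P x)).comp P) x :=
      (hw.differentiable (by simp) (P x)).hasFDerivAt.comp x P.hasFDerivAt
    rw [pderiv, this.fderiv]
    rfl
  have hP0 : P (Pi.single 0 1) = 0 := by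
    ext i; simp [P]
  have hPi : ∀ i : Fin 3, P (Pi.single i.succ 1) = Pi.single i 1 := by
    intro i; ext j; simp [P, Pi.single_apply]
  have hv' : ∀ e, ContDiff ℝ ∞ fun y => fderiv ℝ v y e := fun e =>
    (hv.fderiv_right (m := ∞) (by simp)).clm_apply contDiff_const
  have h₂ : ∀ (i : Fin 3) x, pderiv i.succ (pderiv i.succ fun y => v (P y)) x =
      fderiv ℝ (fun y => fderiv ℝ v y (Pi.single i 1)) (P x) (Pi.single i 1) := by
    intro i x
    have : (pderiv i.succ fun y => v (P y)) = fun y => fderiv ℝ v (P y) (Pi.single i 1) := by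
      ext y
      rw [hP v hv, hPi]
    rw [this, hP _ (hv' _), hPi]
  refine ⟨fun y => v (P y), hv.comp P.contDiff, fun x => by rw [hP v hv, hP0, map_zero],
    fun x => ?_⟩
  have := hvf (P x)
  rw [Fin.sum_univ_three, ← h₂, ← h₂, ← h₂] at this
  exact this

/-! ### Slabs -/

theorem uniqueDiffOn_slab {t₀ t₁ : ℝ} (ht : t₀ < t₁) {Y : Set (Fin 3 → ℝ)} (hY : IsOpen Y) :
    UniqueDiffOn ℝ (slab t₀ t₁ Y) := by
  have h := (uniqueDiffOn_Icc ht).prod hY.uniqueDiffOn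
  exact (Fin.consEquivL ℝ (fun _ : Fin 4 => ℝ)).symm.uniqueDiffOn_preimage_iff.2 h

/-- A function on a slab whose time derivative vanishes does not depend on time. -/
theorem eq_of_pderiv_zero {t₀ t₁ : ℝ} (ht : t₀ < t₁) {Y : Set (Fin 3 → ℝ)} {f : Spacetime → ℝ}
    (hf : ∀ x ∈ slab t₀ t₁ Y, DifferentiableAt ℝ f x)
    (h0 : ∀ x ∈ slab t₀ t₁ Y, pderiv 0 f x = 0) {x : Spacetime} (hx : x ∈ slab t₀ t₁ Y) :
    f x = f (Fin.cons t₀ fun i : Fin 3 => x i.succ) := by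
  set c : ℝ → Spacetime := fun s => Function.update x 0 s with hc
  have hcm : ∀ s ∈ Set.Icc t₀ t₁, c s ∈ slab t₀ t₁ Y := fun s hs => by
    refine ⟨by simpa [hc] using hs, ?_⟩
    simpa [hc] using hx.2
  have hd : ∀ s ∈ Set.Icc t₀ t₁, HasDerivAt (fun s => f (c s)) 0 s := by
    intro s hs
    have h₁ := (hf _ (hcm s hs)).hasFDerivAt.comp_hasDerivAt s (hasDerivAt_update x 0 s)
    have h₂ := h0 _ (hcm s hs)
    rw [pderiv] at h₂
    rwa [h₂] at h₁
  have key := constant_of_derivWithin_zero (f := fun s => f (c s)) (a := t₀) (b := t₁)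
    (fun s hs => (hd s hs).differentiableAt.differentiableWithinAt)
    (fun s hs => (hd s ⟨hs.1, hs.2.le⟩).hasDerivWithinAt.derivWithin
      (uniqueDiffOn_Icc ht s ⟨hs.1, hs.2.le⟩)) (x 0) hx.1
  simp only [hc, Function.update_eq_self] at key
  rw [key]
  congr 1
  ext i
  refine Fin.cases ?_ (fun j => ?_) i <;> simp

/-! ### Algebra of the Hodge dual -/

/-- Both sides are alternating in the indices, and the Vandermonde product at `0, 1, 2, 3` is `12`.
The polynomial form makes `ε` easy to evaluate. -/
theorem det_submatrix_one (a b c d : Fin 4) :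
    12 * Matrix.det ((1 : Matrix (Fin 4) (Fin 4) ℤ).submatrix ![a, b, c, d] id) =
      ((b : ℤ) - a) * (c - a) * (d - a) * (c - b) * (d - b) * (d - c) := by
  revert a b c d
  decide +kernel

theorem ε_eq (a b c d : Fin 4) :
    ε a b c d = ((((b : ℤ) - a) * (c - a) * (d - a) * (c - b) * (d - b) * (d - c) : ℤ) : ℝ) / 12 := by
  rw [← det_submatrix_one, ε]
  push_cast
  ring

/-- The Hodge dual of a two-index array, with lowered indices. -/
def hodgeStar (k : Fin 4 → Fin 4 → ℝ) (a b : Fin 4) : ℝ :=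
  ∑ p, ∑ q, η a p * η b q * ((1 / 2) * ∑ m, ∑ n, ε p q m n * k m n)

/-- The components of the Hodge dual of an antisymmetric array. -/
theorem hodgeStar_eq {k : Fin 4 → Fin 4 → ℝ} (hk : ∀ a b, k a b = -k b a) (a b : Fin 4) :
    hodgeStar k a b = !![0, -k 2 3, -k 3 1, -k 1 2; k 2 3, 0, k 0 3, -k 0 2;
      k 3 1, -k 0 3, 0, k 0 1; k 1 2, k 0 2, -k 0 1, 0] a b := by
  have h₁ := hk 1 0
  have h₂ := hk 2 0
  have h₃ := hk 3 0
  have h₄ := hk 2 1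
  have h₅ := hk 1 3
  have h₆ := hk 3 2
  have hη : ∀ a p, η a p = if a = p then ![1, -1, -1, -1] a else (0 : ℝ) := fun a p => by
    rw [η, Matrix.diagonal_apply]
  simp only [hodgeStar, hη, ite_mul, zero_mul, mul_ite, mul_zero, Finset.sum_ite_eq, Finset.mem_univ,
    if_true, ε_eq]
  fin_cases a <;> fin_cases b <;> simp [Fin.sum_univ_four] <;> linarith

theorem hodgeStar_antisymm {k : Fin 4 → Fin 4 → ℝ} (hk : ∀ a b, k a b = -k b a) (a b : Fin 4) :
    hodgeStar k a b = -hodgeStar k b a := by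
  rw [hodgeStar_eq hk, hodgeStar_eq hk]
  fin_cases a <;> fin_cases b <;> simp

/-- The dual of an array that is divergence-free in its antisymmetric pair is closed. -/
theorem hodgeStar_cyclic_of_div {k : Fin 4 → Fin 4 → Fin 4 → ℝ} (hk : ∀ a m n, k a m n = -k a n m)
    (hdiv : ∀ n, k 0 0 n - k 1 1 n - k 2 2 n - k 3 3 n = 0) (a b c : Fin 4) :
    hodgeStar (k a) b c + hodgeStar (k b) c a + hodgeStar (k c) a b = 0 := by
  have h₀ := hdiv 0
  have h₁ := hdiv 1
  have h₂ := hdiv 2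
  have h₃ := hdiv 3
  have s : ∀ a m, k a m m = 0 := fun a m => by linarith [hk a m m]
  rw [s] at h₀ h₁ h₂ h₃
  rw [hodgeStar_eq (hk a), hodgeStar_eq (hk b), hodgeStar_eq (hk c)]
  fin_cases a <;> fin_cases b <;> fin_cases c <;>
    simp <;> linarith [hk 1 1 0, hk 2 2 0, hk 3 3 0, hk 2 2 1, hk 1 1 3, hk 3 3 2]

/-- The dual of a closed array is divergence-free. -/
theorem hodgeStar_div_of_cyclic {k : Fin 4 → Fin 4 → Fin 4 → ℝ} (hk : ∀ a m n, k a m n = -k a n m)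
    (hcyc : ∀ a b c, k a b c + k b c a + k c a b = 0) (n : Fin 4) :
    hodgeStar (k 0) 0 n - hodgeStar (k 1) 1 n - hodgeStar (k 2) 2 n - hodgeStar (k 3) 3 n = 0 := by
  have h₁ := hcyc 1 2 3
  have h₂ := hcyc 0 2 3
  have h₃ := hcyc 0 1 3
  have h₄ := hcyc 0 1 2
  simp only [hodgeStar_eq (hk _)]
  fin_cases n <;> simp <;> linarith [hk 2 3 0, hk 3 3 0, hk 1 3 0, hk 2 2 0, hk 1 2 0, hk 0 3 1,
    hk 2 0 3, hk 1 0 3, hk 0 1 3, hk 1 3 0]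

/-- The dual of a trace-free array `k_abc` is cyclic. -/
theorem hodgeStar_cyclic_of_trace {k : Fin 4 → Fin 4 → Fin 4 → ℝ} (hk : ∀ c a b, k c a b = -k c b a)
    (htr : ∀ n, k 0 0 n - k 1 1 n - k 2 2 n - k 3 3 n = 0) (a b c : Fin 4) :
    hodgeStar (k c) a b + hodgeStar (k a) b c + hodgeStar (k b) c a = 0 := by
  -- The identity is purely algebraic: the tensor index `c` takes the place of the derivative index.
  linarith [hodgeStar_cyclic_of_div hk htr a b c]

/-! ### Curl, trace and wave operator in components -/

/-- The curl `∂_a h_bc - ∂_b h_ac`, with the last index first. -/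
def curl (h : TensorField₂) (c : Fin 4) (x : Spacetime) (a b : Fin 4) : ℝ :=
  pderiv a (fun y => h y b c) x - pderiv b (fun y => h y a c) x

/-- The wave operator. -/
def dalembertian (f : Spacetime → ℝ) (x : Spacetime) : ℝ :=
  pderiv 0 (pderiv 0 f) x - pderiv 1 (pderiv 1 f) x - pderiv 2 (pderiv 2 f) x
    - pderiv 3 (pderiv 3 f) x

theorem curl_antisymm (h : TensorField₂) (c : Fin 4) (x : Spacetime) (a b : Fin 4) :
    curl h c x a b = -curl h c x b a := by
  simp only [curl]
  ring

theorem sum_η_mul (f : Fin 4 → Fin 4 → ℝ) :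
    ∑ a, ∑ b, η a b * f a b = f 0 0 - f 1 1 - f 2 2 - f 3 3 := by
  simp [Fin.sum_univ_four, η, Matrix.diagonal_apply]
  ring

theorem trace_eq (h : TensorField₂) (x : Spacetime) :
    trace h x = h x 0 0 - h x 1 1 - h x 2 2 - h x 3 3 :=
  sum_η_mul _

/-- The dual has constant coefficients. Each component is zero or plus or minus a single entry, so
no differentiability is needed. -/
theorem pderiv_hodgeStar {k : Spacetime → Fin 4 → Fin 4 → ℝ} (hk : ∀ x a b, k x a b = -k x b a)
    (e a b : Fin 4) (x : Spacetime) :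
    pderiv e (fun y => hodgeStar (k y) a b) x = hodgeStar (fun m n => pderiv e (fun y => k y m n) x) a b := by
  have hk' : ∀ m n, pderiv e (fun y => k y m n) x = -pderiv e (fun y => k y n m) x := by
    intro m n
    rw [← pderiv_neg]
    congr 1
    ext y
    exact hk y m n
  simp only [hodgeStar_eq (hk _)]
  rw [hodgeStar_eq hk']
  fin_cases a <;> fin_cases b <;> simp [pderiv_neg, pderiv_zero]

theorem contDiffOn_hodgeStar {k : Spacetime → Fin 4 → Fin 4 → ℝ} {U : Set Spacetime}
    (hk : ∀ a b, ContDiffOn ℝ ∞ (fun x => k x a b) U) (a b : Fin 4) :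
    ContDiffOn ℝ ∞ (fun x => hodgeStar (k x) a b) U := by
  unfold hodgeStar
  exact ContDiffOn.sum fun p _ => ContDiffOn.sum fun q _ => contDiffOn_const.mul
    (contDiffOn_const.mul (ContDiffOn.sum fun m _ => ContDiffOn.sum fun n _ =>
      contDiffOn_const.mul (hk m n)))

section Fields

variable {h : TensorField₂} {S U : Set Spacetime} {x : Spacetime}

theorem pderiv_minkowski {f : Fin 4 → Spacetime → ℝ} (hf : ∀ i, DifferentiableAt ℝ (f i) x)
    (a : Fin 4) :
    pderiv a (fun y => f 0 y - f 1 y - f 2 y - f 3 y) x =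
      pderiv a (f 0) x - pderiv a (f 1) x - pderiv a (f 2) x - pderiv a (f 3) x := by
  rw [pderiv_sub a (((hf 0).fun_sub (hf 1)).fun_sub (hf 2)) (hf 3),
    pderiv_sub a ((hf 0).fun_sub (hf 1)) (hf 2), pderiv_sub a (hf 0) (hf 1)]

theorem contDiffOn_curl (hU : IsOpen U) (hh : ∀ a b, ContDiffOn ℝ ∞ (fun x => h x a b) U)
    (c a b : Fin 4) : ContDiffOn ℝ ∞ (fun x => curl h c x a b) U :=
  (contDiffOn_pderiv (hh b c) hU a).sub (contDiffOn_pderiv (hh a c) hU b)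

theorem contDiffOn_trace (hh : ∀ a b, ContDiffOn ℝ ∞ (fun x => h x a b) U) :
    ContDiffOn ℝ ∞ (trace h) U := by
  rw [show trace h = fun x => h x 0 0 - h x 1 1 - h x 2 2 - h x 3 3 from funext (trace_eq h)]
  exact (((hh 0 0).sub (hh 1 1)).sub (hh 2 2)).sub (hh 3 3)

theorem pderiv_curl (hU : IsOpen U) (hh : ∀ a b, ContDiffOn ℝ ∞ (fun x => h x a b) U)
    (hx : x ∈ U) (e c a b : Fin 4) :
    pderiv e (fun y => curl h c y a b) x =
      pderiv e (pderiv a fun y => h y b c) x - pderiv e (pderiv b fun y => h y a c) x :=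
  pderiv_sub e (differentiableAt_of_contDiffOn (contDiffOn_pderiv (hh b c) hU a) hU hx)
    (differentiableAt_of_contDiffOn (contDiffOn_pderiv (hh a c) hU b) hU hx)

theorem pderiv_symm (hS : UniqueDiffOn ℝ S) (hU : IsOpen U) (hSU : S ⊆ U)
    (hh : ∀ a b, ContDiffOn ℝ ∞ (fun x => h x a b) U)
    (hsymm : ∀ y ∈ S, ∀ a b, h y a b = h y b a) (hx : x ∈ S) (a b c : Fin 4) :
    pderiv a (fun y => h y b c) x = pderiv a (fun y => h y c b) x :=
  pderiv_congr hS hx (differentiableAt_of_contDiffOn (hh b c) hU (hSU hx))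
    (differentiableAt_of_contDiffOn (hh c b) hU (hSU hx)) (fun y hy => hsymm y hy b c) a

theorem d₁_eq (hS : UniqueDiffOn ℝ S) (hU : IsOpen U) (hSU : S ⊆ U)
    (hh : ∀ a b, ContDiffOn ℝ ∞ (fun x => h x a b) U) (hx : x ∈ S) (a b c : Fin 4) :
    d₁ S h a b c x = pderiv a (fun y => h y b c) x :=
  partialDeriv_eq_pderiv hS hx (differentiableAt_of_contDiffOn (hh b c) hU (hSU hx)) a

theorem d₂_eq (hS : UniqueDiffOn ℝ S) (hU : IsOpen U) (hSU : S ⊆ U)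
    (hh : ∀ a b, ContDiffOn ℝ ∞ (fun x => h x a b) U) (hx : x ∈ S) (a b c d : Fin 4) :
    d₂ S h a b c d x = pderiv a (pderiv b fun y => h y c d) x := by
  rw [d₂, ← partialDeriv_eq_pderiv hS hx (differentiableAt_of_contDiffOn
    (contDiffOn_pderiv (hh c d) hU b) hU (hSU hx)), partialDeriv, partialDeriv,
    fderivWithin_congr (fun y hy => d₁_eq hS hU hSU hh hy b c d) (d₁_eq hS hU hSU hh hx b c d)]

theorem divergence_eq (hS : UniqueDiffOn ℝ S) (hU : IsOpen U) (hSU : S ⊆ U)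
    (hh : ∀ a b, ContDiffOn ℝ ∞ (fun x => h x a b) U) (hx : x ∈ S) (b : Fin 4) :
    divergence S h x b = pderiv 0 (fun y => h y 0 b) x - pderiv 1 (fun y => h y 1 b) x
      - pderiv 2 (fun y => h y 2 b) x - pderiv 3 (fun y => h y 3 b) x := by
  simp only [divergence, sum_η_mul, d₁_eq hS hU hSU hh hx]

/-- The divergence and trace terms vanish in TT gauge, which turns duality into an equation between
curls. -/
theorem fierz_eq (hS : UniqueDiffOn ℝ S) (hU : IsOpen U) (hSU : S ⊆ U)
    (hh : ∀ a b, ContDiffOn ℝ ∞ (fun x => h x a b) U) (hTT : IsTTGaugeOn S h) (hx : x ∈ S)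
    (a b c : Fin 4) : fierz S h x a b c = 1 / 2 * curl h c x a b := by
  have htr : ∀ a, partialDeriv S a (trace h) x = 0 := fun a => by
    rw [partialDeriv_eq_pderiv hS hx (differentiableAt_of_contDiffOn (contDiffOn_trace hh) hU
      (hSU hx))]
    exact pderiv_eq_zero hS hx (differentiableAt_of_contDiffOn (contDiffOn_trace hh) hU
      (hSU hx)) hTT.trace_eq a
  simp only [fierz, htr, hTT.divergence_eq x hx, d₁_eq hS hU hSU hh hx, curl]
  ring

theorem hodgeDual_fierz_eq (hS : UniqueDiffOn ℝ S) (hU : IsOpen U) (hSU : S ⊆ U)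
    (hh : ∀ a b, ContDiffOn ℝ ∞ (fun x => h x a b) U) (hTT : IsTTGaugeOn S h) (hx : x ∈ S)
    (a b c : Fin 4) : hodgeDual (fierz S h) x a b c = 1 / 2 * hodgeStar (curl h c x) a b := by
  simp only [hodgeDual, fierz_eq hS hU hSU hh hTT hx, hodgeStar, Finset.mul_sum]
  refine Finset.sum_congr rfl fun p _ => Finset.sum_congr rfl fun q _ =>
    Finset.sum_congr rfl fun m _ => Finset.sum_congr rfl fun n _ => ?_
  ring

/-- The derivative of the divergence of a divergence-free field. -/
theorem pderiv_divergence_eq_zero (hS : UniqueDiffOn ℝ S) (hU : IsOpen U) (hSU : S ⊆ U)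
    (hh : ∀ a b, ContDiffOn ℝ ∞ (fun x => h x a b) U)
    (hdiv : ∀ x ∈ S, ∀ b, divergence S h x b = 0) (hx : x ∈ S) (a b : Fin 4) :
    pderiv a (pderiv 0 fun y => h y 0 b) x - pderiv a (pderiv 1 fun y => h y 1 b) x
      - pderiv a (pderiv 2 fun y => h y 2 b) x - pderiv a (pderiv 3 fun y => h y 3 b) x = 0 := by
  have hd : ∀ i, DifferentiableAt ℝ (pderiv i fun y => h y i b) x := fun i =>
    differentiableAt_of_contDiffOn (contDiffOn_pderiv (hh i b) hU i) hU (hSU hx)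
  have h₁ := pderiv_minkowski hd a
  rw [← h₁]
  refine pderiv_eq_zero hS hx ((((hd 0).fun_sub (hd 1)).fun_sub (hd 2)).fun_sub (hd 3))
    (fun y hy => ?_) a
  rw [← divergence_eq hS hU hSU hh hy, hdiv y hy]

theorem pderiv_pderiv_trace_eq_zero (hS : UniqueDiffOn ℝ S) (hU : IsOpen U) (hSU : S ⊆ U)
    (hh : ∀ a b, ContDiffOn ℝ ∞ (fun x => h x a b) U)
    (htr : ∀ x ∈ S, trace h x = 0) (hx : x ∈ S) (a b : Fin 4) :
    pderiv a (pderiv b fun y => h y 0 0) x - pderiv a (pderiv b fun y => h y 1 1) x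
      - pderiv a (pderiv b fun y => h y 2 2) x - pderiv a (pderiv b fun y => h y 3 3) x = 0 := by
  have hd : ∀ i, DifferentiableAt ℝ (pderiv b fun y => h y i i) x := fun i =>
    differentiableAt_of_contDiffOn (contDiffOn_pderiv (hh i i) hU b) hU (hSU hx)
  have h₁ := pderiv_minkowski hd a
  rw [← h₁]
  refine pderiv_eq_zero hS hx ((((hd 0).fun_sub (hd 1)).fun_sub (hd 2)).fun_sub (hd 3))
    (fun y hy => ?_) a
  have hd' : ∀ i, DifferentiableAt ℝ (fun y => h y i i) y := fun i =>
    differentiableAt_of_contDiffOn (hh i i) hU (hSU hy)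
  rw [← pderiv_minkowski hd' b]
  refine pderiv_eq_zero hS hy ((((hd' 0).fun_sub (hd' 1)).fun_sub (hd' 2)).fun_sub (hd' 3))
    (fun z hz => ?_) b
  rw [← trace_eq, htr z hz]

/-- In TT gauge the Einstein tensor is `-1/2` times the wave operator. -/
theorem einstein_eq_dalembertian (hS : UniqueDiffOn ℝ S) (hU : IsOpen U) (hSU : S ⊆ U)
    (hh : ∀ a b, ContDiffOn ℝ ∞ (fun x => h x a b) U)
    (hsymm : ∀ y ∈ S, ∀ a b, h y a b = h y b a) (hTT : IsTTGaugeOn S h) (hx : x ∈ S)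
    (a b : Fin 4) : einstein S h x a b = -(1 / 2) * dalembertian (fun y => h y a b) x := by
  have hsymm₂ : ∀ a b c d, pderiv a (pderiv b fun y => h y c d) x =
      pderiv a (pderiv b fun y => h y d c) x := fun a b c d =>
    pderiv_congr hS hx
      (differentiableAt_of_contDiffOn (contDiffOn_pderiv (hh c d) hU b) hU (hSU hx))
      (differentiableAt_of_contDiffOn (contDiffOn_pderiv (hh d c) hU b) hU (hSU hx))
      (fun y hy => pderiv_symm hS hU hSU hh hsymm hy b c d) a
  -- Apart from the wave operator, the terms of the Ricci tensor are derivatives of the divergence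
  -- or the Hessian of the trace.
  have hricci : ∀ a b, ricci S h x a b = -(1 / 2) * dalembertian (fun y => h y a b) x := by
    intro a b
    simp only [ricci, sum_η_mul, riemann, d₂_eq hS hU hSU hh hx, dalembertian]
    have e₁ := pderiv_divergence_eq_zero hS hU hSU hh hTT.divergence_eq hx b a
    have e₂ := pderiv_divergence_eq_zero hS hU hSU hh hTT.divergence_eq hx a b
    have e₃ := pderiv_pderiv_trace_eq_zero hS hU hSU hh hTT.trace_eq hx a b
    have c : ∀ i, pderiv i (pderiv b fun y => h y a i) x =
        pderiv b (pderiv i fun y => h y i a) x := fun i => by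
      rw [hsymm₂, pderiv_comm (hh i a) hU (hSU hx)]
    rw [c, c, c, c]
    linarith
  have hscalar : scalarCurvature S h x = 0 := by
    simp only [scalarCurvature, sum_η_mul, hricci, dalembertian]
    linarith [pderiv_pderiv_trace_eq_zero hS hU hSU hh hTT.trace_eq hx 0 0,
      pderiv_pderiv_trace_eq_zero hS hU hSU hh hTT.trace_eq hx 1 1,
      pderiv_pderiv_trace_eq_zero hS hU hSU hh hTT.trace_eq hx 2 2,
      pderiv_pderiv_trace_eq_zero hS hU hSU hh hTT.trace_eq hx 3 3]
  rw [einstein, hscalar, hricci]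
  ring

/-- The contracted derivative of the curl of a divergence-free field. -/
theorem curl_divergence (hS : UniqueDiffOn ℝ S) (hU : IsOpen U) (hSU : S ⊆ U)
    (hh : ∀ a b, ContDiffOn ℝ ∞ (fun x => h x a b) U)
    (hdiv : ∀ x ∈ S, ∀ b, divergence S h x b = 0) (hx : x ∈ S) (n c : Fin 4) :
    pderiv 0 (fun y => curl h c y 0 n) x - pderiv 1 (fun y => curl h c y 1 n) x
      - pderiv 2 (fun y => curl h c y 2 n) x - pderiv 3 (fun y => curl h c y 3 n) x =
      dalembertian (fun y => h y n c) x := by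
  have e := pderiv_divergence_eq_zero hS hU hSU hh hdiv hx n c
  have hx' := hSU hx
  simp only [pderiv_curl hU hh hx', dalembertian]
  rw [pderiv_comm (hh 0 c) hU hx' 0 n, pderiv_comm (hh 1 c) hU hx' 1 n,
    pderiv_comm (hh 2 c) hU hx' 2 n, pderiv_comm (hh 3 c) hU hx' 3 n]
  linarith

theorem pderiv_curl_antisymm (e c m n : Fin 4) :
    pderiv e (fun y => curl h c y m n) x = -pderiv e (fun y => curl h c y n m) x := by
  rw [← pderiv_neg]
  congr 1
  ext y
  exact curl_antisymm h c y m n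

/-- The dual of the curl of a divergence-free solution of the wave equation is closed. -/
theorem hodgeStar_curl_closed (hU : IsOpen U) (hh : ∀ a b, ContDiffOn ℝ ∞ (fun x => h x a b) U)
    (hdiv : ∀ x ∈ U, ∀ b, divergence U h x b = 0)
    (hwave : ∀ x ∈ U, ∀ a b, dalembertian (fun y => h y a b) x = 0) (hx : x ∈ U)
    (e a b c : Fin 4) :
    pderiv a (fun y => hodgeStar (curl h e y) b c) x + pderiv b (fun y => hodgeStar (curl h e y) c a) x
      + pderiv c (fun y => hodgeStar (curl h e y) a b) x = 0 := by
  simp only [pderiv_hodgeStar (curl_antisymm h e)]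
  refine hodgeStar_cyclic_of_div (k := fun i m n => pderiv i (fun y => curl h e y m n) x)
    (fun i m n => pderiv_curl_antisymm i e m n) (fun n => ?_) a b c
  exact (curl_divergence hU.uniqueDiffOn hU subset_rfl hh hdiv hx n e).trans (hwave x hx n e)

/-- The dual of a curl is divergence-free. -/
theorem hodgeStar_curl_divergence (hU : IsOpen U) (hh : ∀ a b, ContDiffOn ℝ ∞ (fun x => h x a b) U)
    (hx : x ∈ U) (e n : Fin 4) :
    pderiv 0 (fun y => hodgeStar (curl h e y) 0 n) x - pderiv 1 (fun y => hodgeStar (curl h e y) 1 n) x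
      - pderiv 2 (fun y => hodgeStar (curl h e y) 2 n) x
      - pderiv 3 (fun y => hodgeStar (curl h e y) 3 n) x = 0 := by
  simp only [pderiv_hodgeStar (curl_antisymm h e)]
  refine hodgeStar_div_of_cyclic (k := fun i m n => pderiv i (fun y => curl h e y m n) x)
    (fun i m n => pderiv_curl_antisymm i e m n) (fun a b c => ?_) n
  simp only [pderiv_curl hU hh hx]
  rw [pderiv_comm (hh c e) hU hx a b, pderiv_comm (hh b e) hU hx a c,
    pderiv_comm (hh a e) hU hx b c]
  ring

/-- The dual of the curl of a trace-free, divergence-free symmetric field is cyclic. -/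
theorem hodgeStar_curl_cyclic (hU : IsOpen U) (hh : ∀ a b, ContDiffOn ℝ ∞ (fun x => h x a b) U)
    (hsymm : ∀ y ∈ U, ∀ a b, h y a b = h y b a) (hTT : IsTTGaugeOn U h) (hx : x ∈ U)
    (a b c : Fin 4) :
    hodgeStar (curl h c x) a b + hodgeStar (curl h a x) b c + hodgeStar (curl h b x) c a = 0 := by
  refine hodgeStar_cyclic_of_trace (k := fun c => curl h c x) (fun c => curl_antisymm h c x)
    (fun n => ?_) a b c
  -- Contracting `c` with `a` in the curl gives the divergence minus the gradient of the trace; both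
  -- vanish.
  have hS := hU.uniqueDiffOn (𝕜 := ℝ)
  have e₁ := divergence_eq hS hU subset_rfl hh hx n
  rw [hTT.divergence_eq x hx] at e₁
  have e₂ := pderiv_minkowski (f := fun i y => h y i i)
    (fun i => differentiableAt_of_contDiffOn (hh i i) hU hx) n
  rw [pderiv_congr hS hx (differentiableAt_of_contDiffOn (((((hh 0 0).sub (hh 1 1)).sub (hh 2 2)).sub
    (hh 3 3))) hU hx) (differentiableAt_const 0) (fun y hy => by
      rw [← trace_eq]; exact hTT.trace_eq y hy), pderiv_zero] at e₂
  have s : ∀ i, pderiv i (fun y => h y n i) x = pderiv i (fun y => h y i n) x := fun i =>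
    pderiv_symm hS hU subset_rfl hh hsymm hx i n i
  simp only [curl, s]
  linarith

/-- The dual of the curl of a symmetric field is trace-free. -/
theorem hodgeStar_curl_trace (hU : IsOpen U) (hh : ∀ a b, ContDiffOn ℝ ∞ (fun x => h x a b) U)
    (hsymm : ∀ y ∈ U, ∀ a b, h y a b = h y b a) (hx : x ∈ U) (n : Fin 4) :
    hodgeStar (curl h 0 x) 0 n - hodgeStar (curl h 1 x) 1 n - hodgeStar (curl h 2 x) 2 n
      - hodgeStar (curl h 3 x) 3 n = 0 := by
  refine hodgeStar_div_of_cyclic (k := fun c => curl h c x) (fun c => curl_antisymm h c x)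
    (fun a b c => ?_) n
  have s := fun i j k => pderiv_symm hU.uniqueDiffOn hU subset_rfl hh hsymm hx i j k
  simp only [curl]
  rw [s b c a, s c b a, s a c b]
  ring

end Fields

/-! ### Gauge changes and cutoffs -/

/-- For fixed `c` the added term is a gradient, which a curl annihilates. Symmetrisation, temporal
gauge and trace removal are all changes of this form. -/
theorem curl_add_gradient {h : TensorField₂} {A : Spacetime → Fin 4 → ℝ} {U : Set Spacetime}
    {x : Spacetime} (hU : IsOpen U) (hh : ∀ a b, ContDiffOn ℝ ∞ (fun x => h x a b) U)
    (hA : ∀ a, ContDiffOn ℝ ∞ (fun x => A x a) U) (hx : x ∈ U) (c a b : Fin 4) :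
    curl (fun y b c => h y b c + pderiv b (fun z => A z c) y) c x a b = curl h c x a b := by
  have d₁ := fun b => differentiableAt_of_contDiffOn (hh b c) hU hx
  have d₂ := fun b => differentiableAt_of_contDiffOn (contDiffOn_pderiv (hA c) hU b) hU hx
  simp only [curl]
  rw [pderiv_add a (d₁ b) (d₂ b), pderiv_add b (d₁ a) (d₂ a), pderiv_comm (hA c) hU hx a b]
  ring

theorem contDiffOn_add_gradient {h : TensorField₂} {A : Spacetime → Fin 4 → ℝ}
    {U : Set Spacetime} (hU : IsOpen U) (hh : ∀ a b, ContDiffOn ℝ ∞ (fun x => h x a b) U)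
    (hA : ∀ a, ContDiffOn ℝ ∞ (fun x => A x a) U) (b c : Fin 4) :
    ContDiffOn ℝ ∞ (fun y => h y b c + pderiv b (fun z => A z c) y) U :=
  (hh b c).add (contDiffOn_pderiv (hA c) hU b)

/-- If the curl is trace-free, the gradient of the trace is the divergence. -/
theorem pderiv_trace_of_curl {h : TensorField₂} {U : Set Spacetime} {x : Spacetime}
    (hU : IsOpen U) (hh : ∀ a b, ContDiffOn ℝ ∞ (fun x => h x a b) U) (hx : x ∈ U) {n : Fin 4}
    (ht : curl h 0 x 0 n - curl h 1 x 1 n - curl h 2 x 2 n - curl h 3 x 3 n = 0) :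
    pderiv n (trace h) x = pderiv 0 (fun y => h y n 0) x - pderiv 1 (fun y => h y n 1) x
      - pderiv 2 (fun y => h y n 2) x - pderiv 3 (fun y => h y n 3) x := by
  rw [show trace h = fun x => h x 0 0 - h x 1 1 - h x 2 2 - h x 3 3 from funext (trace_eq h),
    pderiv_minkowski (f := fun i y => h y i i)
      (fun i => differentiableAt_of_contDiffOn (hh i i) hU hx) n]
  simp only [curl] at ht
  linarith

/-- A smooth cutoff function that is `1` on a compact subset of an open set. -/
theorem exists_cutoff {K U : Set Spacetime} (hK : IsCompact K) (hU : IsOpen U) (hKU : K ⊆ U) :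
    ∃ χ : Spacetime → ℝ, ContDiff ℝ ∞ χ ∧ HasCompactSupport χ ∧ tsupport χ ⊆ U ∧
      ∀ x ∈ K, χ x = 1 := by
  obtain ⟨L, hL, hKL, hLU⟩ := exists_compact_between hK hU hKU
  obtain ⟨χ, hχ, -, hsupp, hone⟩ := exists_contMDiff_support_eq_eq_one_iff
    (modelWithCornersSelf ℝ Spacetime) (n := ⊤) isOpen_interior hK.isClosed hKL
  have ht : tsupport χ ⊆ L := by
    rw [tsupport, hsupp]
    exact closure_minimal interior_subset hL.isClosed
  exact ⟨χ, hχ.contDiff, hL.of_isClosed_subset (isClosed_tsupport χ) ht, ht.trans hLU,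
    fun x hx => (hone x).1 hx⟩

theorem contDiff_mul_of_tsupport {χ f : Spacetime → ℝ} {U : Set Spacetime} (hχ : ContDiff ℝ ∞ χ)
    (hU : IsOpen U) (hsupp : tsupport χ ⊆ U) (hf : ContDiffOn ℝ ∞ f U) :
    ContDiff ℝ ∞ fun x => χ x * f x := by
  refine contDiff_iff_contDiffAt.2 fun x => ?_
  by_cases hx : x ∈ U
  · exact hχ.contDiffAt.mul (hf.contDiffAt (hU.mem_nhds hx))
  · have h0 : (fun y => χ y * f y) =ᶠ[nhds x] fun _ => 0 := by
      filter_upwards [(isClosed_tsupport χ).isOpen_compl.mem_nhds fun h => hx (hsupp h)] with y hy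
      rw [image_eq_zero_of_notMem_tsupport hy, zero_mul]
    exact contDiffAt_const.congr_of_eventuallyEq h0

/-! ### Construction of the potential and its gauge fixing -/

/-- On a domain with `H² = 0`, the dual of the curl of a TT solution is itself the curl of a
symmetric tensor field. -/
theorem exists_symmetric_potential {Ω : TopologicalSpace.Opens Spacetime}
    (hΩ2 : Subsingleton (DeRham.Cohomology Ω 2)) {h : TensorField₂}
    (hh : ∀ a b, ContDiffOn ℝ ∞ (fun x => h x a b) Ω)
    (hsymm : ∀ y ∈ (Ω : Set Spacetime), ∀ a b, h y a b = h y b a) (hTT : IsTTGaugeOn Ω h)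
    (hwave : ∀ x ∈ (Ω : Set Spacetime), ∀ a b, dalembertian (fun y => h y a b) x = 0) :
    ∃ θ : TensorField₂, (∀ a b, ContDiffOn ℝ ∞ (fun x => θ x a b) Ω) ∧
      (∀ x ∈ (Ω : Set Spacetime), ∀ a b, θ x a b = θ x b a) ∧
      ∀ x ∈ (Ω : Set Spacetime), ∀ c a b, curl θ c x a b = hodgeStar (curl h c x) a b := by
  have hΩ := Ω.isOpen
  choose τ hτ hτB using fun c => exists_covector_potential hΩ2
    (B := fun x => hodgeStar (curl h c x))
    (contDiffOn_hodgeStar (contDiffOn_curl hΩ hh c))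
    (fun x => hodgeStar_antisymm (curl_antisymm h c x))
    (fun x hx => hodgeStar_curl_closed hΩ hh hTT.divergence_eq hwave hx c)
  -- The cyclic identity for the dual curl says that the antisymmetric part of `τ` is closed; the
  -- curl of `A` is chosen to cancel it.
  obtain ⟨A, hA, hAτ⟩ := exists_covector_potential hΩ2
    (B := fun x b c => τ b x c - τ c x b)
    (fun b c => (hτ b c).sub (hτ c b)) (fun x b c => by ring)
    (fun x hx a b c => by
      have d := fun i j => differentiableAt_of_contDiffOn (hτ i j) hΩ hx
      rw [pderiv_sub a (d b c) (d c b), pderiv_sub b (d c a) (d a c), pderiv_sub c (d a b) (d b a)]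
      have h₁ := hτB c x hx a b
      have h₂ := hτB a x hx b c
      have h₃ := hτB b x hx c a
      have h₄ := hodgeStar_curl_cyclic hΩ hh hsymm hTT hx a b c
      linarith)
  have hτ' : ∀ a b, ContDiffOn ℝ ∞ (fun x => (fun y b c => τ c y b : TensorField₂) x a b) Ω :=
    fun a b => hτ b a
  refine ⟨fun y b c => τ c y b + pderiv b (fun z => A z c) y,
    contDiffOn_add_gradient hΩ hτ' hA, fun x hx a b => ?_, fun x hx c a b => ?_⟩
  · have := hAτ x hx a b
    linarith
  · rw [curl_add_gradient hΩ hτ' hA hx]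
    exact hτB c x hx a b

/-- A field on a neighbourhood of a slab whose curl is dual to that of `h` can be brought into
temporal gauge on the slab. -/
theorem exists_temporal_gauge {S : Set Spacetime} {U : TopologicalSpace.Opens Spacetime}
    (hU1 : Subsingleton (DeRham.Cohomology U 1)) (hS : UniqueDiffOn ℝ S)
    {χ : Spacetime → ℝ} (hχ : ContDiff ℝ ∞ χ) (hχc : HasCompactSupport χ)
    (hχU : tsupport χ ⊆ U) (hχS : ∀ x ∈ S, χ x = 1) (hSU : S ⊆ U)
    {θ : TensorField₂} (hθ : ∀ a b, ContDiffOn ℝ ∞ (fun x => θ x a b) U)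
    (hcurl : ∀ x ∈ (U : Set Spacetime), ∀ a b, curl θ 0 x a b = 0) :
    ∃ l : Spacetime → ℝ, ContDiff ℝ ∞ l ∧
      ∀ x ∈ S, ∀ b, θ x b 0 + pderiv b (pderiv 0 l) x = 0 := by
  obtain ⟨μ, hμ, hμθ⟩ := exists_scalar_potential hU1 (A := fun x b => θ x b 0)
    (fun b => hθ b 0) (fun x hx a b => hcurl x hx a b)
  obtain ⟨l, hl, hlμ⟩ := exists_time_primitive
    (contDiff_mul_of_tsupport hχ U.isOpen hχU hμ).neg (hχc.mul_right (f' := μ)).neg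
  refine ⟨l, hl, fun x hx b => ?_⟩
  -- The cutoff is known to be `1` only on `S`, but values on `S` determine derivatives there, also
  -- at the times `t₀` and `t₁`.
  have h₁ : pderiv b (pderiv 0 l) x = pderiv b (fun y => -μ y) x := by
    refine pderiv_congr hS hx
      (differentiableAt_of_contDiffOn (contDiffOn_pderiv hl.contDiffOn isOpen_univ 0) isOpen_univ
        (Set.mem_univ x))
      (differentiableAt_of_contDiffOn hμ U.isOpen (hSU hx)).neg (fun y hy => ?_) b
    rw [hlμ y]
    simp [hχS y hy]
  rw [h₁, pderiv_neg, hμθ x (hSU hx)]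
  ring

theorem contDiff_spatial_slice {q : Spacetime → ℝ} (hq : ContDiff ℝ ∞ q)
    (hqc : HasCompactSupport q) (t : ℝ) :
    ContDiff ℝ ∞ (fun y : Fin 3 → ℝ => q (Fin.cons t y)) ∧
      HasCompactSupport fun y : Fin 3 → ℝ => q (Fin.cons t y) := by
  constructor
  · refine hq.comp (contDiff_pi.2 fun i => ?_)
    refine Fin.cases ?_ (fun j => ?_) i
    · simpa using contDiff_const
    · simpa using contDiff_apply ℝ ℝ j
  · refine HasCompactSupport.intro
      (hqc.isCompact.image (f := fun x : Spacetime => fun i : Fin 3 => x i.succ) (by fun_prop))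
      fun y hy => ?_
    by_contra hne
    exact hy ⟨Fin.cons t y, subset_tsupport _ hne, by ext i; simp⟩

/-- A field that is in temporal gauge on a slab and has trace-free curl can be made trace-free
without leaving the temporal gauge. -/
theorem exists_traceless_gauge {t₀ t₁ : ℝ} (ht : t₀ < t₁) {Y : Set (Fin 3 → ℝ)} (hY : IsOpen Y)
    {U : Set Spacetime} (hU : IsOpen U) (hSU : slab t₀ t₁ Y ⊆ U)
    {χ : Spacetime → ℝ} (hχ : ContDiff ℝ ∞ χ) (hχc : HasCompactSupport χ)
    (hχU : tsupport χ ⊆ U) (hχS : ∀ x ∈ slab t₀ t₁ Y, χ x = 1)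
    {k : TensorField₂} (hk : ∀ a b, ContDiffOn ℝ ∞ (fun x => k x a b) U)
    (hsymm : ∀ x ∈ U, ∀ a b, k x a b = k x b a)
    (htime : ∀ x ∈ slab t₀ t₁ Y, ∀ b, k x b 0 = 0)
    (htr : ∀ x ∈ U, ∀ n,
      curl k 0 x 0 n - curl k 1 x 1 n - curl k 2 x 2 n - curl k 3 x 3 n = 0) :
    ∃ u : Spacetime → ℝ, ContDiff ℝ ∞ u ∧ (∀ x, pderiv 0 u x = 0) ∧
      ∀ x ∈ slab t₀ t₁ Y, pderiv 1 (pderiv 1 u) x + pderiv 2 (pderiv 2 u) x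
        + pderiv 3 (pderiv 3 u) x = trace k x := by
  have hS := uniqueDiffOn_slab ht hY
  have hkt := contDiffOn_trace hk
  have hstatic : ∀ x ∈ slab t₀ t₁ Y, pderiv 0 (trace k) x = 0 := by
    intro x hx
    -- For `n = 0` the gradient of the trace is the divergence of the time components, which are
    -- zero on the slab.
    have h0 : ∀ i, pderiv i (fun y => k y 0 i) x = 0 := fun i =>
      pderiv_eq_zero hS hx (differentiableAt_of_contDiffOn (hk 0 i) hU (hSU hx))
        (fun y hy => by rw [hsymm y (hSU hy), htime y hy]) i
    rw [pderiv_trace_of_curl hU hk (hSU hx) (htr x (hSU hx) 0)]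
    simp [h0]
  -- The source is the trace at time `t₀`, cut off in space; being static, the trace agrees with it
  -- on the whole slab.
  obtain ⟨hf, hfc⟩ := contDiff_spatial_slice (contDiff_mul_of_tsupport hχ hU hχU hkt)
    (hχc.mul_right (f' := trace k)) t₀
  obtain ⟨u, hu, hu0, huf⟩ := exists_static_poisson hf hfc
  refine ⟨u, hu, hu0, fun x hx => ?_⟩
  have hx₀ : (Fin.cons t₀ fun i : Fin 3 => x i.succ : Spacetime) ∈ slab t₀ t₁ Y :=
    ⟨by simp [ht.le], by simpa using hx.2⟩
  rw [huf, hχS _ hx₀, one_mul]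
  exact (eq_of_pderiv_zero ht
    (fun y hy => differentiableAt_of_contDiffOn hkt hU (hSU hy)) hstatic hx).symm

end LinearizedGravity

end

/-! ### Assembly of the TT dual -/

open LinearizedGravity in
theorem mainTheorem4
    (Ω U : TopologicalSpace.Opens LinearizedGravity.Spacetime)
    (hΩ : IsConnected (Ω : Set LinearizedGravity.Spacetime))
    (hΩ2 : Subsingleton (DeRham.Cohomology Ω 2))
    (hU : IsConnected (U : Set LinearizedGravity.Spacetime))
    (hUbdd : Bornology.IsBounded (U : Set LinearizedGravity.Spacetime))
    (hUΩ : closure (U : Set LinearizedGravity.Spacetime) ⊆ Ω)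
    (hU1 : Subsingleton (DeRham.Cohomology U 1))
    (t₀ t₁ : ℝ) (ht : t₀ < t₁)
    (Y : Set (Fin 3 → ℝ)) (hYopen : IsOpen Y) (hY : IsConnected Y)
    (hR : closure (LinearizedGravity.slab t₀ t₁ Y) ⊆ U)
    (h : LinearizedGravity.TensorField₂)
    (hsol : LinearizedGravity.IsVacuumSolutionOn Ω h)
    (hTT : LinearizedGravity.IsTTGaugeOn Ω h) :
    ∃ h' : LinearizedGravity.TensorField₂,
      LinearizedGravity.IsDualOn (LinearizedGravity.slab t₀ t₁ Y) h h' ∧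
      LinearizedGravity.IsTTGaugeOn (LinearizedGravity.slab t₀ t₁ Y) h' := by
  set S := slab t₀ t₁ Y with hSdef
  have hS : UniqueDiffOn ℝ S := uniqueDiffOn_slab ht hYopen
  have hΩo := Ω.isOpen
  have hΩu := hΩo.uniqueDiffOn (𝕜 := ℝ)
  have hUo := U.isOpen
  have hUΩ' : (U : Set Spacetime) ⊆ Ω := subset_closure.trans hUΩ
  have hSU : S ⊆ U := subset_closure.trans hR
  have hSΩ : S ⊆ Ω := hSU.trans hUΩ'
  have hh : ∀ a b, ContDiffOn ℝ ∞ (fun x => h x a b) Ω := fun a b =>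
    contDiffOn_pi.1 (contDiffOn_pi.1 hsol.smooth a) b
  have hwave : ∀ x ∈ (Ω : Set Spacetime), ∀ a b, dalembertian (fun y => h y a b) x = 0 := by
    intro x hx a b
    have := einstein_eq_dalembertian hΩu hΩo subset_rfl hh hsol.symm hTT hx a b
    rw [hsol.einstein_eq x hx] at this
    linarith
  have hTTS : IsTTGaugeOn S h :=
    ⟨fun x hx b => by
      rw [divergence_eq hS hΩo hSΩ hh hx, ← divergence_eq hΩu hΩo subset_rfl hh (hSΩ hx)]
      exact hTT.divergence_eq x (hSΩ hx) b,
    fun x hx => hTT.trace_eq x (hSΩ hx), fun x hx => hTT.time_eq x (hSΩ hx)⟩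
  obtain ⟨θ, hθ, hθs, hθc⟩ := exists_symmetric_potential hΩ2 hh hsol.symm hTT hwave
  have hθU : ∀ a b, ContDiffOn ℝ ∞ (fun x => θ x a b) U := fun a b => (hθ a b).mono hUΩ'
  -- Boundedness of `U` enters here: a compactly supported cutoff equal to `1` on the slab requires
  -- a compact closure.
  have hcompact : IsCompact (closure S) := (hUbdd.subset hSU).isCompact_closure
  obtain ⟨χ, hχ, hχc, hχU, hχ1⟩ := exists_cutoff hcompact hUo hR
  have hχS : ∀ x ∈ S, χ x = 1 := fun x hx => hχ1 x (subset_closure hx)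
  obtain ⟨l, hl, hlθ⟩ := exists_temporal_gauge hU1 hS hχ hχc hχU hχS hSU hθU
    (fun x hx a b => by
      -- `h_a0 = 0` kills the curl with last index `0`, hence also its dual, so `θ_b0` is curl-free.
      have h0 : curl h 0 x = 0 := by
        ext m n
        have z : ∀ n m, pderiv m (fun y => h y n 0) x = 0 := fun n m =>
          pderiv_eq_zero hΩu (hUΩ' hx) (differentiableAt_of_contDiffOn (hh n 0) hΩo (hUΩ' hx))
            (fun y hy => hTT.time_eq y hy n) m
        simp [curl, z]
      rw [hθc x (hUΩ' hx), h0]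
      simp [hodgeStar])
  have hlA : ∀ a, ContDiffOn ℝ ∞ (fun x => pderiv a l x) U := fun a =>
    (contDiffOn_pderiv hl.contDiffOn isOpen_univ a).mono (Set.subset_univ _)
  set k : TensorField₂ := fun y b c => θ y b c + pderiv b (fun z => pderiv c l z) y with hk
  have hks : ∀ a b, ContDiffOn ℝ ∞ (fun x => k x a b) U := contDiffOn_add_gradient hUo hθU hlA
  have hksymm : ∀ x ∈ (U : Set Spacetime), ∀ a b, k x a b = k x b a := fun x hx a b => by
    simp only [hk]
    rw [hθs x (hUΩ' hx) a b]
    exact congrArg _ (pderiv_comm hl.contDiffOn isOpen_univ (Set.mem_univ x) a b)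
  have hkc : ∀ x ∈ (U : Set Spacetime), ∀ c a b, curl k c x a b = hodgeStar (curl h c x) a b :=
    fun x hx c a b => by
      rw [hk, curl_add_gradient hUo hθU hlA hx, hθc x (hUΩ' hx)]
  have htrh := fun x hx => hodgeStar_curl_trace (x := x) hΩo hh hsol.symm (hUΩ' hx)
  obtain ⟨u, hu, hu0, huk⟩ := exists_traceless_gauge ht hYopen hUo hSU hχ hχc hχU hχS hks hksymm
    (fun x hx b => hlθ x hx b) (fun x hx n => by simp only [hkc x hx]; exact htrh x hx n)
  have huA : ∀ a, ContDiffOn ℝ ∞ (fun x => pderiv a u x) U := fun a =>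
    (contDiffOn_pderiv hu.contDiffOn isOpen_univ a).mono (Set.subset_univ _)
  set h' : TensorField₂ := fun y b c => k y b c + pderiv b (fun z => pderiv c u z) y with hh'
  have hs' : ∀ a b, ContDiffOn ℝ ∞ (fun x => h' x a b) U := contDiffOn_add_gradient hUo hks huA
  have hsymm' : ∀ x ∈ (U : Set Spacetime), ∀ a b, h' x a b = h' x b a := fun x hx a b => by
    simp only [hh']
    rw [hksymm x hx a b]
    exact congrArg _ (pderiv_comm hu.contDiffOn isOpen_univ (Set.mem_univ x) a b)
  have hc' : ∀ x ∈ (U : Set Spacetime), ∀ c a b, curl h' c x a b = hodgeStar (curl h c x) a b :=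
    fun x hx c a b => by
      rw [hh', curl_add_gradient hUo hks huA hx, hkc x hx]
  have hu0' : pderiv 0 u = fun _ => 0 := funext hu0
  have htime' : ∀ x ∈ S, ∀ a, h' x a 0 = 0 := fun x hx a => by
    simp only [hh', hu0', pderiv_zero, add_zero]
    exact hlθ x hx a
  -- By the signature and `∂_0 u = 0`, the Hessian of `u` has trace minus its spatial Laplacian,
  -- that is, minus the trace of `k`.
  have htrace' : ∀ x ∈ S, trace h' x = 0 := fun x hx => by
    have h₁ := huk x hx
    have h₂ : pderiv 0 (fun z => pderiv 0 u z) x = 0 := by rw [hu0', pderiv_zero]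
    rw [trace_eq] at h₁
    rw [trace_eq]
    simp only [hh', h₂]
    linarith
  have hdiv' : ∀ x ∈ S, ∀ b, divergence S h' x b = 0 := fun x hx b => by
    have h₁ := pderiv_trace_of_curl hUo hs' (hSU hx) (n := b)
      (by simp only [hc' x (hSU hx)]; exact htrh x (hSU hx) b)
    rw [pderiv_eq_zero hS hx (differentiableAt_of_contDiffOn (contDiffOn_trace hs') hUo (hSU hx))
      htrace'] at h₁
    have s := fun i => pderiv_symm hUo.uniqueDiffOn hUo subset_rfl hs' hsymm' (hSU hx) i b i
    rw [divergence_eq hS hUo hSU hs' hx, ← s, ← s, ← s, ← s, ← h₁]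
  have hTT' : IsTTGaugeOn S h' := ⟨hdiv', htrace', htime'⟩
  have hwave' : ∀ x ∈ S, ∀ a b, dalembertian (fun y => h' y a b) x = 0 := fun x hx a b => by
    -- The wave operator is the divergence of `curl h'`, and the divergence of a dual curl is zero.
    rw [← curl_divergence hS hUo hSU hs' hdiv' hx a b,
      ← hodgeStar_curl_divergence hΩo hh (hSΩ hx) b a]
    have e : ∀ i, pderiv i (fun y => curl h' b y i a) x =
        pderiv i (fun y => hodgeStar (curl h b y) i a) x := fun i =>
      pderiv_congr hUo.uniqueDiffOn (hSU hx)
        (differentiableAt_of_contDiffOn (contDiffOn_curl hUo hs' b i a) hUo (hSU hx))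
        (differentiableAt_of_contDiffOn (contDiffOn_hodgeStar (contDiffOn_curl hΩo hh b) i a) hΩo
          (hSΩ hx)) (fun y hy => hc' y hy b i a) i
    simp only [e]
  refine ⟨h', ⟨⟨hsol.smooth.mono hSΩ, fun x hx => hsol.symm x (hSΩ hx), fun x hx a b => ?_⟩,
    ⟨?_, fun x hx => hsymm' x (hSU hx), fun x hx a b => ?_⟩, fun x hx a b c => ?_⟩, hTT'⟩
  · rw [einstein_eq_dalembertian hS hΩo hSΩ hh (fun y hy => hsol.symm y (hSΩ hy)) hTTS hx,
      hwave x (hSΩ hx), mul_zero]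
  · exact contDiffOn_pi.2 fun a => contDiffOn_pi.2 fun b => (hs' a b).mono hSU
  · rw [einstein_eq_dalembertian hS hUo hSU hs' (fun y hy => hsymm' y (hSU hy)) hTT' hx,
      hwave' x hx, mul_zero]
  · rw [fierz_eq hS hUo hSU hs' hTT' hx, hodgeDual_fierz_eq hS hΩo hSΩ hh hTTS hx,
      hc' x (hSU hx)]
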